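/- **Conventions.** Let $E$ be a (real) vector lattice. Elements $x,y\in E$ are disjoint, $x\perp y$, if $|x|\wedge|y|=0$, and $y$ is a fragment of $x$, $y\sqsubseteq x$, if $y\perp x-y$. For $S\subset E$ put $S^{\perp}=\{x\in E: x\perp y \text{ for all } y\in S\}$. A band $B$ is a solid linear subspace closed under all suprema existing in $E$; it is a projection band if $E=B+B^{\perp}$; $E$ has the projection property if every band in $E$ is a projection band. An atom is an element $u\neq 0$ such that $0\le x\le|u|$, $0\le y\le|u|$, $x\wedge y=0$ imply $x=0$ or $y=0$. A sequence converges laterally, $x_n\xrightarrow{\mathrm{lat}}x$, if $x_n\sqsubseteq x_m\sqsubseteq x$ for $n<m$ and $x_n\to x$ in order. Let $\mathcal U_{\sigma c}(E,\mathbb R)$ be the vector lattice of all maps $T:E\to\mathbb R$ that are orthogonally additive ($T(x+y)=T(x)+T(y)$ whenever $x\perp y$), order bounded (order bounded sets have bounded images) and $\sigma$-laterally continuous ($x_n\xrightarrow{\mathrm{lat}}x$ implies $T(x_n)\to T(x)$), ordered by $S\le T\iff S(x)\le T(x)$ for all $x\in E$. For a vector lattice $L$, let $\Phi_1(L)$ be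 the set of its finite elements, that is, of all $\varphi\in L$ for which there is $z\in L$ such that for each $x\in L$ there is $c_x>0$ with $|x|\wedge n|\varphi|\le c_x z$ for all $n\in\mathbb N$. Call a set $A$ nonmeasurable if every countably complete ultrafilter on $A$ is principal. (Every set of cardinality at most the continuum is nonmeasurable; all sets are nonmeasurable if there are no measurable cardinals, which is consistent with ZFC.) **Theorem.** Let $E$ be a vector lattice with the projection property in which every order bounded set of pairwise disjoint positive elements is nonmeasurable, and let $\varphi\in\Phi_1(\mathcal U_{\sigma c}(E,\mathbb R))$. Then there are finitely many (possibly no) pairwise disjoint atoms $e_1,\dots,e_n$ of $E$ such that the band $M$ generated by $e_1,\dots,e_n$ is a finite-dimensional projection band and $\varphi(x)=0$ for every $x\in M^{\perp}$. -/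

import Mathlib

open Filter Topology

set_option linter.unusedSectionVars false

/-! ### Vector lattices: disjointness, fragments, bands, atoms -/

namespace VL

section Defs

variable {E : Type*} [AddCommGroup E] [Lattice E]

/-- `x ⟂ y`: the elements `x` and `y` of a vector lattice are disjoint. -/
def Disj (x y : E) : Prop := |x| ⊓ |y| = 0

/-- `y ⊑ x`: `y` is a fragment (component) of `x`. -/
def IsFragment (y x : E) : Prop := Disj y (x - y)

/-- The disjoint complement of a set. -/
def disjCompl (S : Set E) : Set E := {x | ∀ y ∈ S, Disj x y}

/-- Order convergence of a sequence: `|x n - a|` is dominated by a sequence decreasing to `0`. -/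
def OrderConv (x : ℕ → E) (a : E) : Prop :=
  ∃ r : ℕ → E, Antitone r ∧ IsGLB (Set.range r) 0 ∧ ∀ n, |x n - a| ≤ r n

/-- Lateral convergence of a sequence: `x n ⊑ x m ⊑ a` for `n < m`, and `x n → a` in order. -/
def LatConv (x : ℕ → E) (a : E) : Prop :=
  (∀ n m, n < m → IsFragment (x n) (x m)) ∧ (∀ n, IsFragment (x n) a) ∧ OrderConv x a

/-- An atom of a vector lattice. -/
def IsAtomElt (u : E) : Prop :=
  u ≠ 0 ∧ ∀ x y : E, 0 ≤ x → x ≤ |u| → 0 ≤ y → y ≤ |u| → x ⊓ y = 0 → x = 0 ∨ y = 0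

variable [Module ℝ E]

/-- A band: a solid linear subspace that contains every supremum, existing in `E`,
of a subset of itself. -/
def IsBand (B : Submodule ℝ E) : Prop :=
  LatticeOrderedAddCommGroup.IsSolid (B : Set E) ∧
    ∀ (S : Set E) (x : E), S ⊆ (B : Set E) → IsLUB S x → x ∈ B

/-- A projection band: a band `B` with `E = B + B^⊥` (the sum is then direct). -/
def IsProjectionBand (B : Submodule ℝ E) : Prop :=
  IsBand B ∧ ∀ x : E, ∃ y ∈ B, ∃ z ∈ disjCompl (B : Set E), x = y + z

/-- The band generated by a set: the intersection of all bands that contain it. -/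
def bandGenerated (S : Set E) : Submodule ℝ E :=
  sInf {B : Submodule ℝ E | IsBand B ∧ S ⊆ (B : Set E)}

variable (E) in
/-- The projection property: every band is a projection band. -/
def ProjectionProperty : Prop := ∀ B : Submodule ℝ E, IsBand B → IsProjectionBand B

/-- A finite element `φ` of a vector lattice: there is `z` (a majorant of `φ`) such that for all `x`
there is `c > 0` with `|x| ∧ n|φ| ≤ c z` for all `n`. The set of finite elements of `E` is
denoted by `Φ₁(E)`. -/
def IsFiniteElement (φ : E) : Prop :=
  ∃ z : E, ∀ x : E, ∃ c : ℝ, 0 < c ∧ ∀ n : ℕ, |x| ⊓ n • |φ| ≤ c • z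

end Defs

/-- A set (type) is *nonmeasurable*, in the sense of measurable cardinals, if every countably
complete ultrafilter on it is principal. -/
def IsNonmeasurable (X : Type*) : Prop :=
  ∀ U : Ultrafilter X, CountableInterFilter (U : Filter X) → ∃ a : X, U = pure a

/-! ### Elementary facts on fragments -/

section Lemmas

variable {E : Type*} [AddCommGroup E] [Lattice E] [IsOrderedAddMonoid E]

theorem Disj.symm {x y : E} (h : Disj x y) : Disj y x := by
  unfold Disj at *; rwa [inf_comm]

theorem inf_zero_mono {a b x y : E} (ha : 0 ≤ a) (hb : 0 ≤ b) (hax : a ≤ x) (hby : b ≤ y)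
    (h : x ⊓ y = 0) : a ⊓ b = 0 :=
  le_antisymm ((inf_le_inf hax hby).trans h.le) (le_inf ha hb)

theorem Disj.mono {a b x y : E} (h : Disj x y) (ha : |a| ≤ |x|) (hb : |b| ≤ |y|) : Disj a b :=
  inf_zero_mono (abs_nonneg _) (abs_nonneg _) ha hb h

theorem add_inf_le_add {u v w : E} (hu : 0 ≤ u) (hv : 0 ≤ v) (hw : 0 ≤ w) :
    w ⊓ (u + v) ≤ w ⊓ u + w ⊓ v := by
  rw [inf_add, add_inf, add_inf]
  refine le_inf (le_inf ?_ ?_) (le_inf ?_ ?_)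
  · exact inf_le_left.trans (le_add_of_nonneg_left hw)
  · exact inf_le_left.trans (le_add_of_nonneg_right hv)
  · exact inf_le_left.trans (le_add_of_nonneg_left hu)
  · exact inf_le_right

theorem sup_eq_add_of_inf {u v : E} (h : u ⊓ v = 0) : u ⊔ v = u + v := by
  have := inf_add_sup u v
  rwa [h, zero_add] at this

theorem inf_add_of_inf {u v w : E} (hu : 0 ≤ u) (hv : 0 ≤ v) (hw : 0 ≤ w) (h : u ⊓ v = 0) :
    w ⊓ (u + v) = w ⊓ u + w ⊓ v := by
  refine le_antisymm (add_inf_le_add hu hv hw) (le_inf ?_ (add_le_add inf_le_right inf_le_right))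
  have h0 : (w ⊓ u) ⊓ (w ⊓ v) = 0 :=
    inf_zero_mono (le_inf hw hu) (le_inf hw hv) inf_le_right inf_le_right h
  rw [← sup_eq_add_of_inf h0]
  exact sup_le inf_le_left inf_le_left

theorem Disj.add_left {x y z : E} (hx : Disj x z) (hy : Disj y z) : Disj (x + y) z := by
  unfold Disj at *
  refine le_antisymm ?_ (le_inf (abs_nonneg _) (abs_nonneg _))
  rw [inf_comm]
  calc |z| ⊓ |x + y| ≤ |z| ⊓ (|x| + |y|) := inf_le_inf_left _ (abs_add_le x y)
    _ ≤ |z| ⊓ |x| + |z| ⊓ |y| := add_inf_le_add (abs_nonneg _) (abs_nonneg _) (abs_nonneg _)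
    _ = 0 := by rw [inf_comm |z| |x|, inf_comm |z| |y|, hx, hy, add_zero]

theorem Disj.add_right {x y z : E} (hx : Disj z x) (hy : Disj z y) : Disj z (x + y) :=
  (hx.symm.add_left hy.symm).symm

theorem bounds_of_abs_le {x w : E} (h : |x| ≤ w) : -w ≤ x ∧ x ≤ w :=
  ⟨neg_le.1 ((neg_le_abs x).trans h), (le_abs_self x).trans h⟩

theorem posPart_le_abs (x : E) : x⁺ ≤ |x| := by
  rw [← posPart_add_negPart]; exact le_add_of_nonneg_right (negPart_nonneg x)

theorem negPart_le_abs (x : E) : x⁻ ≤ |x| := by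
  rw [← posPart_add_negPart]; exact le_add_of_nonneg_left (posPart_nonneg x)

theorem posPart_eq_of_sub {x p q : E} (hx : x = p - q) (h : p ⊓ q = 0) : x⁺ = p := by
  have h1 : x⁺ = (p ⊔ q) - q := by
    rw [posPart_def, hx, sup_sub, sub_self]
  rw [h1, sup_eq_add_of_inf h, add_sub_cancel_right]

theorem Disj.posPart_add {a b : E} (h : Disj a b) : (a + b)⁺ = a⁺ + b⁺ := by
  refine posPart_eq_of_sub (q := a⁻ + b⁻) ?_ ?_
  · rw [add_sub_add_comm, posPart_sub_negPart, posPart_sub_negPart]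
  · have ha := posPart_nonneg a
    have hb := posPart_nonneg b
    have ha' := negPart_nonneg a
    have hb' := negPart_nonneg b
    have e1 : a⁺ ⊓ b⁻ = 0 := inf_zero_mono ha hb' (posPart_le_abs a) (negPart_le_abs b) h
    have e2 : b⁺ ⊓ a⁻ = 0 := inf_zero_mono hb ha' (posPart_le_abs b) (negPart_le_abs a) h.symm
    have e3 := posPart_inf_negPart_eq_zero a
    have e4 := posPart_inf_negPart_eq_zero b
    refine le_antisymm ?_ (le_inf (add_nonneg ha hb) (add_nonneg ha' hb'))
    have f1 : a⁺ ⊓ (a⁻ + b⁻) ≤ 0 :=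
      (add_inf_le_add ha' hb' ha).trans (by rw [e1, e3, add_zero])
    have f2 : b⁺ ⊓ (a⁻ + b⁻) ≤ 0 :=
      (add_inf_le_add ha' hb' hb).trans (by rw [e2, e4, add_zero])
    rw [inf_comm]
    refine (add_inf_le_add ha hb (add_nonneg ha' hb')).trans ?_
    rw [inf_comm _ a⁺, inf_comm _ b⁺]
    exact (add_le_add f1 f2).trans (add_zero 0).le

theorem Disj.neg {a b : E} (h : Disj a b) : Disj (-a) (-b) := by
  unfold Disj at *; rwa [abs_neg, abs_neg]

theorem Disj.negPart_add {a b : E} (h : Disj a b) : (a + b)⁻ = a⁻ + b⁻ := by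
  have := h.neg.posPart_add
  rwa [← neg_add, posPart_neg, posPart_neg, posPart_neg] at this

theorem IsFragment.posPart_le {y x : E} (h : IsFragment y x) : y⁺ ≤ x⁺ := by
  have := Disj.posPart_add h
  rw [add_sub_cancel] at this
  rw [this]; exact le_add_of_nonneg_right (posPart_nonneg _)

theorem IsFragment.negPart_le {y x : E} (h : IsFragment y x) : y⁻ ≤ x⁻ := by
  have := Disj.negPart_add h
  rw [add_sub_cancel] at this
  rw [this]; exact le_add_of_nonneg_right (negPart_nonneg _)

theorem IsFragment.abs_le {y x : E} (h : IsFragment y x) : |y| ≤ |x| := by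
  rw [← posPart_add_negPart, ← posPart_add_negPart]
  exact add_le_add h.posPart_le h.negPart_le

theorem IsFragment.compl {y x : E} (h : IsFragment y x) : IsFragment (x - y) x := by
  unfold IsFragment at *; rw [sub_sub_cancel]; exact h.symm

theorem isFragment_zero (x : E) : IsFragment 0 x := by
  unfold IsFragment Disj
  rw [abs_zero]; exact inf_eq_left.2 (abs_nonneg _)

/-- The common part of `y` and `a`; for two fragments of one element it is their intersection. -/
def common (y a : E) : E := y⁺ ⊓ a⁺ - y⁻ ⊓ a⁻

theorem common_comm (y a : E) : common y a = common a y := by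
  unfold common; rw [inf_comm, inf_comm y⁻]

theorem abs_common_le (y a : E) : |common y a| ≤ |y| := by
  have hp : 0 ≤ y⁺ ⊓ a⁺ := le_inf (posPart_nonneg _) (posPart_nonneg _)
  have hn : 0 ≤ y⁻ ⊓ a⁻ := le_inf (negPart_nonneg _) (negPart_nonneg _)
  unfold common
  rw [abs_le']
  constructor
  · exact (sub_le_self _ hn).trans (inf_le_left.trans (posPart_le_abs y))
  · rw [neg_sub]
    exact (sub_le_self _ hp).trans (inf_le_left.trans (negPart_le_abs y))

theorem abs_common_le' (y a : E) : |common y a| ≤ |a| := by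
  rw [common_comm]; exact abs_common_le a y

theorem common_add {y a b : E} (h : Disj a b) : common y (a + b) = common y a + common y b := by
  unfold common
  rw [h.posPart_add, h.negPart_add,
    inf_add_of_inf (posPart_nonneg _) (posPart_nonneg _) (posPart_nonneg _)
      (inf_zero_mono (posPart_nonneg _) (posPart_nonneg _) (posPart_le_abs a) (posPart_le_abs b) h),
    inf_add_of_inf (negPart_nonneg _) (negPart_nonneg _) (negPart_nonneg _)
      (inf_zero_mono (negPart_nonneg _) (negPart_nonneg _) (negPart_le_abs a) (negPart_le_abs b) h)]
  abel

theorem IsFragment.common_eq {y x : E} (h : IsFragment y x) : common y x = y := by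
  unfold common
  rw [inf_eq_left.2 h.posPart_le, inf_eq_left.2 h.negPart_le, posPart_sub_negPart]

/-- If `x = a ⊔ b` (disjoint sum) and `z` is a fragment of `x`, then `z` splits accordingly. -/
theorem IsFragment.split {z a b : E} (hab : Disj a b) (h : IsFragment z (a + b)) :
    z = common z a + common z b := by
  rw [← common_add hab, h.common_eq]

theorem isFragment_left {a b : E} (hab : Disj a b) : IsFragment a (a + b) := by
  unfold IsFragment; rwa [add_sub_cancel_left]

theorem IsFragment.common_isFragment {z a b : E} (hab : Disj a b) (h : IsFragment z (a + b)) :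
    IsFragment (common z a) a := by
  have h1 : a = common a z + common a (a + b - z) := by
    have e := common_add (y := a) h
    rw [add_sub_cancel, (isFragment_left hab).common_eq] at e
    exact e
  have h2 : a - common z a = common a (a + b - z) := by
    rw [common_comm z a]; exact sub_eq_of_eq_add' h1
  unfold IsFragment
  rw [h2]
  exact Disj.mono h (abs_common_le _ _) (abs_common_le' _ _)

theorem IsFragment.add {z w a b : E} (hab : Disj a b) (hz : IsFragment z a) (hw : IsFragment w b) :
    IsFragment (z + w) (a + b) := by
  unfold IsFragment
  rw [add_sub_add_comm]
  have h1 : Disj z (b - w) := hab.mono hz.abs_le hw.compl.abs_le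
  have h2 : Disj w (a - z) := hab.symm.mono hw.abs_le hz.compl.abs_le
  exact Disj.add_left (Disj.add_right hz h1) (Disj.add_right h2 hw)

theorem IsFragment.trans {z y x : E} (hz : IsFragment z y) (hy : IsFragment y x) :
    IsFragment z x := by
  have h := IsFragment.add hy hz (isFragment_zero (x - y))
  rwa [add_zero, add_sub_cancel] at h

/-- Intersecting a fragment of the limit with a laterally converging sequence. -/
theorem LatConv.common {x : ℕ → E} {a z : E} (hx : LatConv x a) (hz : IsFragment z a) :
    LatConv (fun n => common z (x n)) z := by
  obtain ⟨h1, h2, r, hr, hr0, hrx⟩ := hx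
  have key : ∀ n, z = VL.common z (x n) + VL.common z (a - x n) := fun n =>
    IsFragment.split (h2 n) (by rwa [add_sub_cancel])
  refine ⟨fun n m hnm => ?_, fun n => ?_, r, hr, hr0, fun n => ?_⟩
  · have e : VL.common z (x m) = VL.common z (x n) + VL.common z (x m - x n) := by
      rw [← common_add (h1 n m hnm), add_sub_cancel]
    show IsFragment _ _
    simp only [e]
    exact isFragment_left ((h1 n m hnm).mono (abs_common_le' _ _) (abs_common_le' _ _))
  · have e := isFragment_left
      ((h2 n).mono (abs_common_le' z (x n)) (abs_common_le' z (a - x n)))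
    rwa [← key n] at e
  · refine le_trans ?_ (hrx n)
    have e : VL.common z (x n) - z = -VL.common z (a - x n) := by
      rw [eq_neg_iff_add_eq_zero, sub_add_eq_add_sub, ← key n, sub_self]
    simp only [e]
    rw [abs_neg, abs_sub_comm (x n) a]
    exact abs_common_le' _ _

end Lemmas

/-- In `ℝ`, order convergence of sequences is ordinary convergence. -/
theorem orderConv_real_iff {x : ℕ → ℝ} {a : ℝ} : OrderConv x a ↔ Tendsto x atTop (𝓝 a) := by
  constructor
  · rintro ⟨r, hr, hr0, hx⟩
    have h : Tendsto r atTop (𝓝 0) := tendsto_atTop_isGLB hr hr0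
    rw [tendsto_iff_norm_sub_tendsto_zero]
    exact squeeze_zero (fun n => norm_nonneg _) hx h
  · intro h
    have h0 : Tendsto (fun n => |x n - a|) atTop (𝓝 0) := by
      simpa [Real.norm_eq_abs] using (tendsto_iff_norm_sub_tendsto_zero.1 h)
    have hbdd : ∀ n, BddAbove (Set.range fun k : ℕ => |x (n + k) - a|) := fun n =>
      h0.bddAbove_range.mono (by rintro _ ⟨k, rfl⟩; exact ⟨n + k, rfl⟩)
    refine ⟨fun n => ⨆ k : ℕ, |x (n + k) - a|, fun n m hnm => ?_, ⟨?_, ?_⟩, fun n => ?_⟩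
    · refine ciSup_le fun k => ?_
      have := le_ciSup (hbdd n) (m - n + k)
      simpa [show n + (m - n + k) = m + k by omega] using this
    · rintro _ ⟨n, rfl⟩
      exact Real.iSup_nonneg fun k => abs_nonneg _
    · intro b hb
      refine le_of_forall_pos_le_add fun ε hε => ?_
      obtain ⟨N, hN⟩ := (h0.eventually (gt_mem_nhds hε)).exists_forall_of_atTop
      refine (hb ⟨N, rfl⟩).trans ?_
      rw [zero_add]
      exact ciSup_le fun k => (hN (N + k) (Nat.le_add_right _ _)).le
    · have := le_ciSup (hbdd n) 0
      simpa using this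

/-! ### Abstract Uryson functionals -/

section Uryson

variable {E : Type*} [AddCommGroup E] [Lattice E]

/-- Orthogonally additive maps. -/
def OrthogonallyAdditive {X : Type*} [AddCommGroup X] (T : E → X) : Prop :=
  ∀ x y : E, Disj x y → T (x + y) = T x + T y

/-- Order bounded maps: order bounded sets have order bounded images. -/
def OrderBoundedMap {F : Type*} [Preorder F] (T : E → F) : Prop :=
  ∀ A : Set E, BddBelow A → BddAbove A → BddBelow (T '' A) ∧ BddAbove (T '' A)

/-- `σ`-laterally continuous maps. -/
def SigmaLaterallyContinuous {F : Type*} [AddCommGroup F] [Lattice F] (T : E → F) : Prop :=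
  ∀ (x : ℕ → E) (a : E), LatConv x a → OrderConv (fun n => T (x n)) (T a)

theorem sigmaLaterallyContinuous_iff {T : E → ℝ} : SigmaLaterallyContinuous T ↔
    ∀ (x : ℕ → E) (a : E), LatConv x a → Tendsto (fun n => T (x n)) atTop (𝓝 (T a)) := by
  simp only [SigmaLaterallyContinuous, orderConv_real_iff]

theorem orderBoundedMap_iff {T : E → ℝ} : OrderBoundedMap T ↔
    ∀ A : Set E, BddBelow A → BddAbove A → ∃ K : ℝ, ∀ x ∈ A, |T x| ≤ K := by
  refine forall_congr' fun A => forall_congr' fun _ => forall_congr' fun _ => ⟨?_, ?_⟩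
  · rintro ⟨⟨l, hl⟩, ⟨u, hu⟩⟩
    refine ⟨max |l| |u|, fun x hx => ?_⟩
    exact abs_le_max_abs_abs (hl ⟨x, hx, rfl⟩) (hu ⟨x, hx, rfl⟩)
  · rintro ⟨K, hK⟩
    refine ⟨⟨-K, ?_⟩, ⟨K, ?_⟩⟩
    · rintro _ ⟨x, hx, rfl⟩; exact (abs_le.1 (hK x hx)).1
    · rintro _ ⟨x, hx, rfl⟩; exact (abs_le.1 (hK x hx)).2

variable (E) in
/-- `𝒰_{σc}(E, ℝ)`: the vector space of `σ`-laterally continuous abstract Uryson functionals, that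
is, orthogonally additive, order bounded and `σ`-laterally continuous maps `E → ℝ`. Its order
`S ≤ T ↔ ∀ x, S x ≤ T x` is the pointwise one, inherited from `E → ℝ` (its lattice operations are
not pointwise). -/
def UrysonSC : Submodule ℝ (E → ℝ) where
  carrier := {T | OrthogonallyAdditive T ∧ OrderBoundedMap T ∧ SigmaLaterallyContinuous T}
  zero_mem' := by
    refine ⟨fun x y _ => by simp, orderBoundedMap_iff.2 fun A _ _ => ⟨0, fun x _ => by simp⟩,
      sigmaLaterallyContinuous_iff.2 fun x a _ => ?_⟩
    simp
  add_mem' := by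
    rintro S T ⟨hS1, hS2, hS3⟩ ⟨hT1, hT2, hT3⟩
    refine ⟨fun x y h => ?_, orderBoundedMap_iff.2 fun A h1 h2 => ?_,
      sigmaLaterallyContinuous_iff.2 fun x a h => ?_⟩
    · simp only [Pi.add_apply, hS1 x y h, hT1 x y h]; ring
    · obtain ⟨K, hK⟩ := orderBoundedMap_iff.1 hS2 A h1 h2
      obtain ⟨L, hL⟩ := orderBoundedMap_iff.1 hT2 A h1 h2
      exact ⟨K + L, fun x hx => (abs_add_le _ _).trans (add_le_add (hK x hx) (hL x hx))⟩
    · exact (sigmaLaterallyContinuous_iff.1 hS3 x a h).add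
        (sigmaLaterallyContinuous_iff.1 hT3 x a h)
  smul_mem' := by
    rintro c T ⟨hT1, hT2, hT3⟩
    refine ⟨fun x y h => ?_, orderBoundedMap_iff.2 fun A h1 h2 => ?_,
      sigmaLaterallyContinuous_iff.2 fun x a h => ?_⟩
    · simp only [Pi.smul_apply, hT1 x y h, smul_add]
    · obtain ⟨L, hL⟩ := orderBoundedMap_iff.1 hT2 A h1 h2
      refine ⟨|c| * L, fun x hx => ?_⟩
      rw [Pi.smul_apply, smul_eq_mul, abs_mul]
      exact mul_le_mul_of_nonneg_left (hL x hx) (abs_nonneg c)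
    · exact (sigmaLaterallyContinuous_iff.1 hT3 x a h).const_smul c

/-- The positive part of `T` in the order of `𝒰_{σc}(E, ℝ)`: `T⁺ x = sup {T z : z ⊑ x}`. -/
noncomputable def urysonPos (T : E → ℝ) (x : E) : ℝ := sSup (T '' {z | IsFragment z x})

variable [IsOrderedAddMonoid E]

theorem bddAbove_urysonPos {T : E → ℝ} (hT : OrderBoundedMap T) (x : E) :
    BddAbove (T '' {z | IsFragment z x}) :=
  (hT {z | IsFragment z x} ⟨-|x|, fun _ hz => (bounds_of_abs_le (IsFragment.abs_le hz)).1⟩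
    ⟨|x|, fun _ hz => (bounds_of_abs_le (IsFragment.abs_le hz)).2⟩).2

theorem le_urysonPos {T : E → ℝ} (hT : OrderBoundedMap T) {z x : E} (h : IsFragment z x) :
    T z ≤ urysonPos T x :=
  le_csSup (bddAbove_urysonPos hT x) ⟨z, h, rfl⟩

theorem urysonPos_le {T : E → ℝ} {x : E} {K : ℝ} (h : ∀ z, IsFragment z x → T z ≤ K) :
    urysonPos T x ≤ K := by
  refine csSup_le ⟨T 0, 0, isFragment_zero x, rfl⟩ ?_
  rintro _ ⟨z, hz, rfl⟩
  exact h z hz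

theorem urysonPos_mem {T : E → ℝ} (hT : T ∈ UrysonSC E) : urysonPos T ∈ UrysonSC E := by
  obtain ⟨h1, h2, h3⟩ := hT
  have h0 : T 0 = 0 := by
    have := h1 0 0 (by simp [Disj])
    simpa using this
  have hnn : ∀ x, 0 ≤ urysonPos T x := fun x => by
    rw [← h0]; exact le_urysonPos h2 (isFragment_zero x)
  refine ⟨fun a b hab => le_antisymm ?_ ?_, orderBoundedMap_iff.2 fun A hl hu => ?_,
    sigmaLaterallyContinuous_iff.2 fun x a hx => ?_⟩
  · refine urysonPos_le fun z hz => ?_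
    have hz' : IsFragment z (b + a) := by rwa [add_comm]
    rw [hz.split hab, h1 _ _ (hab.mono (abs_common_le' _ _) (abs_common_le' _ _))]
    exact add_le_add (le_urysonPos h2 (hz.common_isFragment hab))
      (le_urysonPos h2 (hz'.common_isFragment hab.symm))
  · rw [← le_sub_iff_add_le]
    refine urysonPos_le fun z hz => ?_
    rw [le_sub_comm]
    refine urysonPos_le fun w hw => ?_
    rw [le_sub_iff_add_le', ← h1 z w (hab.mono hz.abs_le hw.abs_le)]
    exact le_urysonPos h2 (hz.add hab hw)
  · obtain ⟨l, hl⟩ := hl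
    obtain ⟨u, hu⟩ := hu
    obtain ⟨K, hK⟩ := orderBoundedMap_iff.1 h2 (Set.Icc (-(|l| ⊔ |u|)) (|l| ⊔ |u|))
      bddBelow_Icc bddAbove_Icc
    refine ⟨K, fun x hx => ?_⟩
    rw [abs_of_nonneg (hnn x)]
    refine urysonPos_le fun z hz => (le_abs_self _).trans (hK z ?_)
    have hxw : |x| ≤ |l| ⊔ |u| := by
      rw [abs_le']
      constructor
      · exact (hu hx).trans ((le_abs_self u).trans le_sup_right)
      · exact (neg_le_neg (hl hx)).trans ((neg_le_abs l).trans le_sup_left)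
    exact bounds_of_abs_le (hz.abs_le.trans hxw)
  · have hle : ∀ n, urysonPos T (x n) ≤ urysonPos T a := fun n =>
      urysonPos_le fun z hz => le_urysonPos h2 (hz.trans (hx.2.1 n))
    refine tendsto_order.2 ⟨fun b hb => ?_, fun b hb => Eventually.of_forall fun n =>
      (hle n).trans_lt hb⟩
    obtain ⟨_, ⟨z, hz, rfl⟩, hbz⟩ := exists_lt_of_lt_csSup
      (⟨T 0, 0, isFragment_zero a, rfl⟩ : (T '' {z | IsFragment z a}).Nonempty) hb
    have ht := sigmaLaterallyContinuous_iff.1 h3 _ _ (hx.common hz)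
    filter_upwards [ht.eventually (lt_mem_nhds hbz)] with n hn
    refine hn.trans_le (le_urysonPos h2 ?_)
    have hz' : IsFragment z (x n + (a - x n)) := by rwa [add_sub_cancel]
    exact hz'.common_isFragment (hx.2.1 n)

/-- The vector lattice structure of `𝒰_{σc}(E, ℝ)`, for the pointwise order:
`S ∨ T = S + (T - S)⁺` and `S ∧ T = -((-S) ∨ (-T))`. -/
noncomputable instance : Lattice (UrysonSC E) :=
  let sup : UrysonSC E → UrysonSC E → UrysonSC E := fun S T =>
    S + ⟨urysonPos ((T - S : UrysonSC E) : E → ℝ), urysonPos_mem (T - S).2⟩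
  have hzero : ∀ S : UrysonSC E, (S : E → ℝ) 0 = 0 := fun S => by
    have := S.2.1 0 0 (by simp [Disj])
    simpa using this
  have hleft : ∀ S T : UrysonSC E, S ≤ sup S T := fun S T x => by
    have h := le_urysonPos (T - S).2.2.1 (isFragment_zero x)
    rw [hzero] at h
    exact le_add_of_nonneg_right h
  have hright : ∀ S T : UrysonSC E, T ≤ sup S T := fun S T x => by
    have hx : IsFragment x x := by
      have := (isFragment_zero x).compl
      rwa [sub_zero] at this
    have h := le_urysonPos (T - S).2.2.1 hx
    exact sub_le_iff_le_add'.1 h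
  have hleast : ∀ S T R : UrysonSC E, S ≤ R → T ≤ R → sup S T ≤ R := fun S T R hS hT x => by
    have h : urysonPos ((T - S : UrysonSC E) : E → ℝ) x ≤ (R : E → ℝ) x - (S : E → ℝ) x := by
      refine urysonPos_le fun z hz => ?_
      have e1 := S.2.1 z (x - z) hz
      have e2 := R.2.1 z (x - z) hz
      rw [add_sub_cancel] at e1 e2
      have e3 : (T : E → ℝ) z ≤ (R : E → ℝ) z := hT z
      have e4 : (S : E → ℝ) (x - z) ≤ (R : E → ℝ) (x - z) := hS (x - z)
      show (T : E → ℝ) z - (S : E → ℝ) z ≤ _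
      linarith
    exact le_sub_iff_add_le'.1 h
  { (inferInstance : PartialOrder (UrysonSC E)) with
    sup := sup
    le_sup_left := hleft
    le_sup_right := hright
    sup_le := hleast
    inf := fun S T => -sup (-S) (-T)
    inf_le_left := fun S T => neg_le.1 (hleft (-S) (-T))
    inf_le_right := fun S T => neg_le.1 (hright (-S) (-T))
    le_inf := fun R S T h1 h2 => le_neg.1 (hleast _ _ _ (neg_le_neg h1) (neg_le_neg h2)) }

end Uryson

end VL

/-! Put `p = |φ|` and let `z` be a majorant of `φ`. Finiteness says that every functional lying
below a given `T` and below some multiple of `p` lies below `c z`, where `c` depends only on `T`.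
The argument plays this against test functionals `T = ∑ₖ tₖ p(gₖ ∧ ·)`, where `g ∧ x` is the
greatest common fragment (`meet`); each summand lies below a multiple of `p`, so `tₖ p(gₖ) ≤ c
z(gₖ)` for all `k` (`exists_bound_of_majorant`).

Rapidly decreasing weights give `δ > 0` with `z ≥ δ` wherever `p > 0` (`exists_pos_le_majorant`).
Since `z` is additive on disjoint elements, an element with `p > 0` can be split into pieces charged
by `p` only finitely often, so it has a fragment `f` on which `p` is two-valued
(`exists_two_valued_fragment`). If `p` did not vanish on the band of a disjoint family of null
fragments of `f`, it would induce on the family a countably complete nonprincipal ultrafilter,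
countable completeness coming from `σ`-lateral continuity (`IsNullBand.iUnion`,
`isNullBand_of_two_valued`). Nonmeasurability forbids this, so a maximal such family can be
discarded; what remains of `f` is an atom charged by `p` (`exists_atom_of_two_valued`).

A disjoint sequence of atoms charged by `p` would meet each order interval in finitely many terms,
so arbitrarily large weights would be admissible, contradicting the bound by `c z`
(`not_infinite_atoms`). Hence a maximal disjoint set of such atoms is finite. An `x` disjoint from
it with `φ x ≠ 0` would have a further such atom as a fragment. Finally, the projection property
makes `E` Archimedean, so the band of finitely many atoms lies in their span. -/

namespace VL

/-! ### Disjoint complements and fragments -/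

section Disjointness

variable {E : Type*} [AddCommGroup E] [Lattice E] [IsOrderedAddMonoid E]

theorem disj_zero_right (x : E) : Disj x 0 := by
  unfold Disj
  rw [abs_zero]; exact inf_eq_right.2 (abs_nonneg _)

theorem Disj.neg_right {x y : E} (h : Disj x y) : Disj x (-y) := by
  unfold Disj at *; rwa [abs_neg]

theorem Disj.sub_right {x y z : E} (hx : Disj z x) (hy : Disj z y) : Disj z (x - y) := by
  rw [sub_eq_add_neg]; exact hx.add_right hy.neg_right

theorem Disj.eq_zero {x : E} (h : Disj x x) : x = 0 := by
  unfold Disj at h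
  rw [inf_idem] at h
  have := bounds_of_abs_le h.le
  rw [neg_zero] at this
  exact le_antisymm this.2 this.1

theorem Disj.eq_zero_of_abs_le {x y : E} (h : Disj x y) (hxy : |x| ≤ |y|) : x = 0 :=
  (h.mono le_rfl hxy).eq_zero

theorem Disj.abs_right {x y : E} (h : Disj x y) : Disj x |y| := by
  unfold Disj at *; rwa [abs_abs]

theorem Disj.nsmul_right {x y : E} (h : Disj x y) (n : ℕ) : Disj x (n • y) := by
  induction n with
  | zero => rw [zero_nsmul]; exact disj_zero_right x
  | succ n ih => rw [succ_nsmul]; exact ih.add_right h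

theorem abs_smul_le [Module ℝ E] [IsOrderedModule ℝ E] (c : ℝ) (y : E) :
    |c • y| ≤ |c| • |y| := by
  have h1 : ∀ d : ℝ, d • y ≤ |d| • |y| := fun d => by
    rcases le_total 0 d with hd | hd
    · rw [abs_of_nonneg hd]
      exact smul_le_smul_of_nonneg_left (le_abs_self y) hd
    · rw [abs_of_nonpos hd, ← neg_smul_neg]
      exact smul_le_smul_of_nonneg_left (neg_le_abs y) (neg_nonneg.2 hd)
  refine abs_le'.2 ⟨h1 c, ?_⟩
  rw [← neg_smul, ← abs_neg c]
  exact h1 (-c)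

theorem Disj.smul_right [Module ℝ E] [IsOrderedModule ℝ E] {x y : E} (h : Disj x y) (c : ℝ) :
    Disj x (c • y) := by
  obtain ⟨n, hn⟩ := exists_nat_ge |c|
  refine (h.abs_right.nsmul_right n).mono le_rfl ?_
  rw [abs_of_nonneg (nsmul_nonneg (abs_nonneg y) n), ← Nat.cast_smul_eq_nsmul ℝ]
  exact (abs_smul_le c y).trans (smul_le_smul_of_nonneg_right hn (abs_nonneg y))

theorem IsFragment.refl (x : E) : IsFragment x x := by
  simpa using (isFragment_zero x).compl

theorem IsFragment.antisymm {x y : E} (h : IsFragment x y) (h' : IsFragment y x) : x = y := by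
  unfold IsFragment at h h'
  have h1 : Disj (y - x) (y - x) := by
    have h2 : Disj y (y - x) := by simpa using h'.neg_right
    exact (h2.symm.sub_right h.symm)
  exact (sub_eq_zero.1 h1.eq_zero).symm

theorem isFragment_of_disj_add {x a b : E} (hx : x = a + b) (h : Disj a b) : IsFragment a x :=
  hx ▸ isFragment_left h

/-- A fragment of `x` disjoint from another fragment `a` is a fragment of `x - a`. -/
theorem IsFragment.sub_of_disj {x a b : E} (hb : IsFragment b x) (h : Disj b a) :
    IsFragment b (x - a) := by
  unfold IsFragment at *
  rw [sub_right_comm]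
  exact hb.sub_right h

theorem disjCompl_anti {S T : Set E} (h : S ⊆ T) : disjCompl T ⊆ disjCompl S :=
  fun _ hx y hy => hx y (h hy)

theorem disjCompl_solid {S : Set E} {x y : E} (hy : y ∈ disjCompl S) (h : |x| ≤ |y|) :
    x ∈ disjCompl S :=
  fun a ha => (hy a ha).mono h le_rfl

theorem subset_disjCompl_disjCompl (S : Set E) : S ⊆ disjCompl (disjCompl S) :=
  fun _ hx _ hy => (hy _ hx).symm

/-- For `y` disjoint from `T`, the element `|x| ⊓ |y|` is disjoint from `T` because of `y` and from
`S` because of `x`; so it is disjoint from `x`, which dominates it. -/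
theorem mem_of_mem_disjCompl_union {S T : Set E} {x : E}
    (hx : x ∈ disjCompl (disjCompl (T ∪ S))) (hS : x ∈ disjCompl S) :
    x ∈ disjCompl (disjCompl T) := by
  intro y hy
  have h0 : (0 : E) ≤ |x| ⊓ |y| := le_inf (abs_nonneg _) (abs_nonneg _)
  have h1 : |x| ⊓ |y| ∈ disjCompl (T ∪ S) := by
    rintro a (ha | ha)
    · refine disjCompl_solid hy ?_ a ha
      rw [abs_of_nonneg h0]; exact inf_le_right
    · refine disjCompl_solid hS ?_ a ha
      rw [abs_of_nonneg h0]; exact inf_le_left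
  refine (hx _ h1).symm.eq_zero_of_abs_le ?_
  rw [abs_of_nonneg h0]; exact inf_le_left

end Disjointness

/-! ### Bands, the Archimedean property and the band of an atom -/

section Bands

variable {E : Type*} [AddCommGroup E] [Lattice E] [IsOrderedAddMonoid E] [Module ℝ E]

/-- Such an `x` is a least element of `E`, so `x ≤ 0` and `x ≤ x + x`. This settles the empty set in
the closure condition of `IsBand`. -/
theorem isLUB_empty_eq_zero {x : E} (h : IsLUB (∅ : Set E) x) : x = 0 := by
  have h1 : ∀ y, x ≤ y := fun y => h.2 (by simp)
  exact le_antisymm (h1 0) (by simpa using h1 (x + x))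

theorem IsBand.bandGenerated (S : Set E) : IsBand (bandGenerated S) := by
  have mem : ∀ x, x ∈ VL.bandGenerated S ↔ ∀ B : Submodule ℝ E, IsBand B ∧ S ⊆ (B : Set E) →
      x ∈ B := fun x => by
    simp [VL.bandGenerated, Submodule.mem_sInf]
  refine ⟨fun x hx y hyx => ?_, fun T x hT hx => ?_⟩
  · rw [SetLike.mem_coe, mem] at *
    exact fun B hB => hB.1.1 (hx B hB) hyx
  · rw [mem]
    exact fun B hB => hB.1.2 T x (fun t ht => (mem t).1 (hT ht) B hB) hx

theorem subset_bandGenerated (S : Set E) : S ⊆ (bandGenerated S : Set E) := fun x hx => by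
  rw [SetLike.mem_coe, bandGenerated, Submodule.mem_sInf]
  exact fun B hB => hB.2 hx

variable [IsOrderedModule ℝ E]

/-- The disjoint complement of a set, as a linear subspace. -/
def disjComplSubmodule (S : Set E) : Submodule ℝ E where
  carrier := disjCompl S
  zero_mem' := fun y _ => (disj_zero_right y).symm
  add_mem' := fun ha hb y hy => (ha y hy).add_left (hb y hy)
  smul_mem' := fun c _ hx y hy => ((hx y hy).symm.smul_right c).symm

theorem isBand_disjCompl (S : Set E) : IsBand (disjComplSubmodule S) := by
  refine ⟨fun x hx y hyx => disjCompl_solid hx hyx, fun A x hA hx y hy => ?_⟩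
  rcases A.eq_empty_or_nonempty with rfl | ⟨s, hs⟩
  · rw [isLUB_empty_eq_zero hx]; exact (disj_zero_right y).symm
  have hpos : Disj x⁺ y := by
    set d := x⁺ ⊓ |y| with hd
    have hd0 : 0 ≤ d := le_inf (posPart_nonneg _) (abs_nonneg _)
    -- Each `a⁺` is disjoint from `d`, so `a⁺ + d = a⁺ ⊔ d ≤ x⁺`. Thus `x⁺ - d` is again an upper
    -- bound of `A`, which forces `d = 0`.
    have hub : ∀ a ∈ A, a ≤ x⁺ - d := fun a ha => by
      have h1 : a⁺ ⊓ d = 0 := inf_zero_mono (posPart_nonneg _) hd0 (posPart_le_abs a) inf_le_right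
        (hA ha y hy)
      refine (le_posPart a).trans (le_sub_iff_add_le.2 ?_)
      rw [← sup_eq_add_of_inf h1]
      exact sup_le (posPart_mono (hx.1 ha)) inf_le_left
    have h1 : x ≤ x⁺ - d := hx.2 hub
    have h2 : 0 ≤ x⁺ - d := sub_nonneg.2 inf_le_left
    have h3 : x⁺ ≤ x⁺ - d := sup_le h1 h2
    have h4 : d = 0 := le_antisymm (by simpa using h3) hd0
    unfold Disj
    rw [abs_of_nonneg (posPart_nonneg x), ← hd, h4]
  have hneg : Disj x⁻ y := by
    refine (hA hs y hy).mono ?_ le_rfl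
    rw [abs_of_nonneg (negPart_nonneg x)]
    refine le_trans ?_ (negPart_le_abs s)
    rw [negPart_def, negPart_def]
    exact sup_le_sup_right (neg_le_neg (hx.1 hs)) 0
  rw [← posPart_sub_negPart x]
  exact (hpos.symm.sub_right hneg.symm).symm

theorem ProjectionProperty.exists_decomp (hE : ProjectionProperty E) (S : Set E) (x : E) :
    ∃ a ∈ disjCompl S, ∃ b ∈ disjCompl (disjCompl S), x = a + b :=
  (hE _ (isBand_disjCompl S)).2 x

/-- The elements that are infinitely small with respect to `y`. -/
def infinitesimals (y : E) (hy : 0 ≤ y) : Submodule ℝ E where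
  carrier := {z | ∀ c : ℝ, 0 < c → |z| ≤ c • y}
  zero_mem' := fun c hc => by rw [abs_zero]; exact smul_nonneg hc.le hy
  add_mem' := fun {a b} ha hb c hc => by
    refine (abs_add_le a b).trans ((add_le_add (ha (c / 2) (half_pos hc))
      (hb (c / 2) (half_pos hc))).trans_eq ?_)
    rw [← add_smul, add_halves]
  smul_mem' := fun d x hx c hc => by
    have h0 := abs_nonneg d
    have h1 : 0 < |d| + 1 := by linarith
    refine (abs_smul_le d x).trans ((smul_le_smul_of_nonneg_left
      (hx (c / (|d| + 1)) (div_pos hc h1)) h0).trans ?_)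
    rw [smul_smul]
    refine smul_le_smul_of_nonneg_right ?_ hy
    rw [mul_div_left_comm]
    exact mul_le_of_le_one_right hc.le ((div_le_one h1).2 (by linarith))

theorem isBand_infinitesimals (y : E) (hy : 0 ≤ y) : IsBand (infinitesimals y hy) := by
  refine ⟨fun x hx z hzx c hc => hzx.trans (hx c hc), fun S w hS hw c hc => ?_⟩
  rcases S.eq_empty_or_nonempty with rfl | ⟨s, hs⟩
  · rw [isLUB_empty_eq_zero hw, abs_zero]; exact smul_nonneg hc.le hy
  refine abs_le'.2 ⟨hw.2 fun t ht => (le_abs_self t).trans (hS ht c hc), ?_⟩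
  exact (neg_le_neg (hw.1 hs)).trans ((neg_le_abs s).trans (hS hs c hc))

/-- A vector lattice with the projection property is Archimedean. -/
theorem ProjectionProperty.eq_zero_of_abs_le (hE : ProjectionProperty E) {x y : E}
    (h : ∀ c : ℝ, 0 < c → |x| ≤ c • y) : x = 0 := by
  have hy : 0 ≤ y := (abs_nonneg x).trans (by simpa using h 1 one_pos)
  -- The infinitesimal part `a` of `y` satisfies `2|a| ≤ y ≤ |a| + |b|`, so `|a| ≤ |b|` and `a = 0`.
  -- Then `y` is disjoint from the infinitesimal `x`, although `|x| ≤ y`.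
  obtain ⟨a, ha, b, hb, e⟩ := (hE _ (isBand_infinitesimals y hy)).2 y
  have h1 : |a| ≤ |b| := by
    have h2 : (2 : ℝ) • |a| ≤ |a| + |b| := by
      have h3 := smul_le_smul_of_nonneg_left (ha (1 / 2) (by norm_num)) (zero_le_two (α := ℝ))
      rw [smul_smul] at h3
      norm_num at h3
      refine h3.trans ((le_abs_self y).trans ?_)
      nth_rewrite 1 [e]
      exact abs_add_le a b
    rw [two_smul] at h2
    exact le_of_add_le_add_left h2
  have ha0 : a = 0 := (hb a ha).symm.eq_zero_of_abs_le h1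
  rw [ha0, zero_add] at e
  refine ((hb x h).symm.eq_zero_of_abs_le ?_)
  rw [← e, abs_of_nonneg hy]
  simpa using h 1 one_pos

theorem ProjectionProperty.le_of_forall_add (hE : ProjectionProperty E) {x y w : E}
    (h : ∀ c : ℝ, 0 < c → x ≤ y + c • w) (hw : 0 ≤ w) : x ≤ y := by
  have h1 : (x - y)⁺ = 0 := hE.eq_zero_of_abs_le (y := w) fun c hc => by
    rw [abs_of_nonneg (posPart_nonneg _)]
    exact sup_le (sub_le_iff_le_add'.2 (h c hc)) (smul_nonneg hc.le hw)
  exact sub_nonpos.1 (posPart_eq_zero.1 h1)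

/-- In the band of an atom every positive element is a multiple of the atom. -/
theorem ProjectionProperty.exists_smul_eq_of_nonneg (hE : ProjectionProperty E) {u v : E}
    (hu : IsAtomElt u) (hv0 : 0 ≤ v) (hv : v ∈ disjCompl (disjCompl {u})) :
    ∃ c : ℝ, v = c • |u| := by
  have hu0 : 0 ≤ |u| := abs_nonneg u
  -- Comparability with multiples of the atom: one of `w⁺`, `w⁻` is disjoint from `u`, and it
  -- vanishes because `w⁺ ≤ t • |u|` and `w⁻ ≤ v` both lie in the band of `u`.
  have dich : ∀ t : ℝ, 0 ≤ t → ¬ t • |u| ≤ v → v ≤ t • |u| := fun t ht htv => by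
    set w := t • |u| - v with hw
    have hwp := posPart_nonneg w
    have hwn := negPart_nonneg w
    have h0 : (w⁺ ⊓ |u|) ⊓ (w⁻ ⊓ |u|) = 0 := inf_zero_mono (le_inf hwp hu0) (le_inf hwn hu0)
      inf_le_left inf_le_left (posPart_inf_negPart_eq_zero w)
    rcases hu.2 _ _ (le_inf hwp hu0) inf_le_right (le_inf hwn hu0) inf_le_right h0 with h | h
    · exfalso
      have h1 : Disj w⁺ u := by unfold Disj; rwa [abs_of_nonneg hwp]
      have h2 : w⁺ = 0 := (h1.abs_right.smul_right t).eq_zero_of_abs_le (by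
        rw [abs_of_nonneg hwp, abs_of_nonneg (smul_nonneg ht hu0)]
        exact sup_le (sub_le_self _ hv0) (smul_nonneg ht hu0))
      exact htv (sub_nonpos.1 (posPart_eq_zero.1 h2))
    · have h1 : Disj w⁻ u := by unfold Disj; rwa [abs_of_nonneg hwn]
      have h2 : w⁻ ∈ disjCompl {u} := by rintro _ rfl; exact h1
      have h3 : w⁻ = 0 := (hv _ h2).symm.eq_zero_of_abs_le (by
        rw [abs_of_nonneg hwn, abs_of_nonneg hv0]
        refine sup_le ?_ hv0
        rw [hw, neg_sub]
        exact sub_le_self _ (smul_nonneg ht hu0))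
      exact sub_nonneg.1 (negPart_eq_zero.1 h3)
  -- The coefficient is `sSup A`; the Archimedean property makes it finite and removes the error `c
  -- • |u|` in both inequalities.
  set A : Set ℝ := {t | 0 ≤ t ∧ t • |u| ≤ v} with hA
  have hne : A.Nonempty := ⟨0, le_rfl, by rwa [zero_smul]⟩
  have hbdd : BddAbove A := by
    by_contra hcon
    refine hu.1 (hE.eq_zero_of_abs_le (y := v) fun c hc => ?_)
    obtain ⟨t, ht, hct⟩ := not_bddAbove_iff.1 hcon c⁻¹
    have h1 : c⁻¹ • |u| ≤ v := (smul_le_smul_of_nonneg_right hct.le hu0).trans ht.2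
    have h2 := smul_le_smul_of_nonneg_left h1 hc.le
    rwa [smul_smul, mul_inv_cancel₀ hc.ne', one_smul] at h2
  have hs0 : 0 ≤ sSup A := le_csSup hbdd ⟨le_rfl, by rwa [zero_smul]⟩
  refine ⟨sSup A, le_antisymm ?_ ?_⟩
  · refine hE.le_of_forall_add (w := |u|) (fun c hc => ?_) hu0
    rw [← add_smul]
    refine dich _ (by linarith) fun h => ?_
    have := le_csSup hbdd (show sSup A + c ∈ A from ⟨by linarith, h⟩)
    linarith
  · refine hE.le_of_forall_add (w := |u|) (fun c hc => ?_) hu0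
    obtain ⟨t, ht, hlt⟩ := exists_lt_of_lt_csSup hne (sub_lt_self (sSup A) hc)
    calc sSup A • |u| ≤ (t + c) • |u| := smul_le_smul_of_nonneg_right (by linarith) hu0
      _ ≤ v + c • |u| := by rw [add_smul]; exact add_le_add_left ht.2 _

/-- An atom has a sign: `u⁺` and `u⁻` are disjoint and below `|u|`, so one of them is zero. -/
theorem IsAtomElt.abs {u : E} (hu : IsAtomElt u) :
    ∃ c : ℝ, |u| = c • u := by
  have h1 := posPart_nonneg u
  have h2 := negPart_nonneg u
  have h3 := posPart_sub_negPart u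
  have h4 := posPart_add_negPart u
  rcases hu.2 u⁺ u⁻ h1 (posPart_le_abs u) h2 (negPart_le_abs u) (posPart_inf_negPart_eq_zero u)
    with h | h
  · exact ⟨-1, by rw [← h4, h, zero_add, neg_smul, one_smul]; rw [h, zero_sub] at h3; exact neg_eq_iff_eq_neg.1 h3⟩
  · exact ⟨1, by rw [h, add_zero] at h4; rw [h, sub_zero] at h3; rw [← h4, one_smul, h3]⟩

/-- The band of an atom is one-dimensional. -/
theorem ProjectionProperty.mem_span_atom (hE : ProjectionProperty E) {u v : E}
    (hu : IsAtomElt u) (hv : v ∈ disjCompl (disjCompl {u})) : v ∈ Submodule.span ℝ {u} := by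
  have key : ∀ w : E, 0 ≤ w → |w| ≤ |v| → w ∈ Submodule.span ℝ {u} := fun w hw hwv => by
    obtain ⟨c, hc⟩ := hE.exists_smul_eq_of_nonneg hu hw (disjCompl_solid hv hwv)
    obtain ⟨d, hd⟩ := hu.abs
    rw [hc, hd]
    exact Submodule.smul_mem _ _ (Submodule.smul_mem _ _ (Submodule.mem_span_singleton_self u))
  rw [← posPart_sub_negPart v]
  refine Submodule.sub_mem _ (key _ (posPart_nonneg v) ?_) (key _ (negPart_nonneg v) ?_)
  · rw [abs_of_nonneg (posPart_nonneg v)]; exact posPart_le_abs v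
  · rw [abs_of_nonneg (negPart_nonneg v)]; exact negPart_le_abs v

/-- Modulo the span of finitely many atoms, every element is disjoint from these atoms. -/
theorem ProjectionProperty.exists_sub_mem_disjCompl (hE : ProjectionProperty E) (s : Finset E)
    (hs : ∀ u ∈ s, IsAtomElt u) (x : E) :
    ∃ y ∈ Submodule.span ℝ (s : Set E), x - y ∈ disjCompl (s : Set E) ∧ |x - y| ≤ |x| := by
  classical
  induction s using Finset.induction_on with
  | empty => exact ⟨0, Submodule.zero_mem _, by simp [disjCompl], by simp⟩
  | insert u s _ ih =>
    obtain ⟨y, hy, hxy, hle⟩ := ih fun v hv => hs v (Finset.mem_insert_of_mem hv)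
    obtain ⟨a, ha, b, hb, e⟩ := hE.exists_decomp {u} (x - y)
    have hb' := hE.mem_span_atom (hs u (Finset.mem_insert_self u s)) hb
    have hax : |a| ≤ |x - y| := IsFragment.abs_le (isFragment_of_disj_add e (hb a ha).symm)
    have e' : x - (y + b) = a := by rw [← sub_sub, e, add_sub_cancel_right]
    refine ⟨y + b, Submodule.add_mem _ (Submodule.span_mono (by simp) hy)
      (Submodule.span_mono (by simp) hb'), ?_, ?_⟩
    · rw [e', Finset.coe_insert]
      rintro v (rfl | hv)
      · exact ha v rfl
      · exact (hxy v hv).mono hax le_rfl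
    · rw [e']; exact hax.trans hle

/-- The double complement of `s` is a band containing `s`, so it contains `x` and the remainder `x -
y` of `x` modulo the span. That remainder is also disjoint from `s`, hence zero. -/
theorem ProjectionProperty.bandGenerated_le_span (hE : ProjectionProperty E) (s : Finset E)
    (hs : ∀ u ∈ s, IsAtomElt u) :
    bandGenerated (s : Set E) ≤ Submodule.span ℝ (s : Set E) := by
  intro x hx
  obtain ⟨y, hy, hxy, hle⟩ := hE.exists_sub_mem_disjCompl s hs x
  have h1 : x ∈ disjComplSubmodule (disjCompl (s : Set E)) :=
    (Submodule.mem_sInf.1 hx) _ ⟨isBand_disjCompl _, subset_disjCompl_disjCompl _⟩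
  have h2 : x - y = 0 := (disjCompl_solid h1 hle _ hxy).eq_zero
  rwa [sub_eq_zero.1 h2]

end Bands

/-! ### Greatest common fragments -/

section Meet

variable {E : Type*} [AddCommGroup E] [Lattice E] [IsOrderedAddMonoid E]
  [Module ℝ E] [IsOrderedModule ℝ E]

/-- Any two elements have a greatest common fragment. -/
theorem ProjectionProperty.exists_greatest_common_fragment (hE : ProjectionProperty E) (g x : E) :
    ∃ c, IsFragment c g ∧ IsFragment c x ∧ ∀ f, IsFragment f g → IsFragment f x →
      IsFragment f c := by
  -- `c` is the part of `g` off the band where `g` and `x` differ. A common fragment `f` is disjoint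
  -- from `x - f` and `g - f`, hence from `x - g`, and so fits into `c`.
  obtain ⟨c, hc, r, hr, e⟩ := hE.exists_decomp {x - g} g
  have hcr : Disj c r := (hr c hc).symm
  refine ⟨c, isFragment_of_disj_add e hcr, ?_, fun f hfg hfx => ?_⟩
  · have h1 : x - c = (x - g) + r := by
      rw [sub_add_eq_add_sub, sub_eq_sub_iff_add_eq_add, add_assoc, add_comm r c, ← e]
    unfold IsFragment
    rw [h1]
    exact (hc _ rfl).add_right hcr
  · have h1 : f ∈ disjCompl {x - g} := by
      rintro _ rfl
      have := Disj.sub_right hfx hfg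
      rwa [sub_sub_sub_cancel_right] at this
    have h2 : c - f = (g - f) - r := by rw [e]; abel
    unfold IsFragment
    rw [h2]
    exact Disj.sub_right hfg (hr f h1).symm

/-- The greatest common fragment of two elements (of a lattice with the projection property). -/
noncomputable def meet (hE : ProjectionProperty E) (g x : E) : E :=
  (hE.exists_greatest_common_fragment g x).choose

variable (hE : ProjectionProperty E)

theorem meet_left (g x : E) : IsFragment (meet hE g x) g :=
  (hE.exists_greatest_common_fragment g x).choose_spec.1

theorem meet_right (g x : E) : IsFragment (meet hE g x) x :=
  (hE.exists_greatest_common_fragment g x).choose_spec.2.1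

theorem isFragment_meet {g x f : E} (hg : IsFragment f g) (hx : IsFragment f x) :
    IsFragment f (meet hE g x) :=
  (hE.exists_greatest_common_fragment g x).choose_spec.2.2 f hg hx

theorem meet_self (g : E) : meet hE g g = g :=
  (meet_left hE g g).antisymm (isFragment_meet hE (.refl g) (.refl g))

/-- A common fragment of `g` and `x + y` splits along `x` and `y` into common fragments; conversely,
disjoint fragments of `g` add up to a fragment of `g`. This is what makes `p(g ∧ ·)` orthogonally
additive. -/
theorem meet_add (g : E) {x y : E} (h : Disj x y) :
    meet hE g (x + y) = meet hE g x + meet hE g y := by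
  have hx := meet_right hE g x
  have hy := meet_right hE g y
  have hxy : Disj (meet hE g x) (meet hE g y) := h.mono hx.abs_le hy.abs_le
  refine IsFragment.antisymm ?_ ?_
  · have hD := meet_right hE g (x + y)
    have hD' : IsFragment (meet hE g (x + y)) (y + x) := by rwa [add_comm y x]
    have hsplit := hD.split h
    have h1 := hD.common_isFragment h
    have h2 := hD'.common_isFragment h.symm
    have h12 : Disj (common (meet hE g (x + y)) x) (common (meet hE g (x + y)) y) :=
      h.mono (abs_common_le' _ _) (abs_common_le' _ _)
    have f1 := (isFragment_of_disj_add hsplit h12).trans (meet_left hE g _)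
    have f2 := (isFragment_of_disj_add (hsplit.trans (add_comm _ _)) h12.symm).trans
      (meet_left hE g _)
    rw [hsplit]
    exact IsFragment.add hxy (isFragment_meet hE f1 h1) (isFragment_meet hE f2 h2)
  · refine isFragment_meet hE ?_ (IsFragment.add h hx hy)
    unfold IsFragment
    have h1 := (IsFragment.sub_of_disj (meet_left hE g x) hxy)
    have h2 := (IsFragment.sub_of_disj (meet_left hE g y) hxy.symm)
    unfold IsFragment at h1 h2
    rw [sub_right_comm, sub_sub] at h1
    rw [sub_sub] at h2
    exact h1.add_left h2

end Meet

/-! ### Test functionals and lower bounds for the majorant -/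

section Functionals

variable {E : Type*} [AddCommGroup E] [Lattice E] [IsOrderedAddMonoid E]

theorem UrysonSC.map_zero (T : UrysonSC E) : (T : E → ℝ) 0 = 0 := by
  have := T.2.1 0 0 (by simp [Disj])
  simpa using this

theorem UrysonSC.map_fragment_add (T : UrysonSC E) {f e : E} (h : IsFragment f e) :
    (T : E → ℝ) e = (T : E → ℝ) f + (T : E → ℝ) (e - f) := by
  rw [← T.2.1 _ _ h, add_sub_cancel]

theorem UrysonSC.mono_fragment {T : UrysonSC E} (hT : ∀ x, 0 ≤ (T : E → ℝ) x) {f e : E}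
    (h : IsFragment f e) : (T : E → ℝ) f ≤ (T : E → ℝ) e := by
  rw [UrysonSC.map_fragment_add T h]; exact le_add_of_nonneg_right (hT _)

theorem UrysonSC.map_fragment_eq_zero {T : UrysonSC E} (hT : ∀ x, 0 ≤ (T : E → ℝ) x) {f e : E}
    (h : IsFragment f e) (he : (T : E → ℝ) e = 0) : (T : E → ℝ) f = 0 :=
  le_antisymm (he ▸ UrysonSC.mono_fragment hT h) (hT f)

/-- A positive functional and a positive majorant that witness finiteness of `φ`. -/
theorem IsFiniteElement.exists_majorant {φ : UrysonSC E} (hφ : IsFiniteElement φ) :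
    ∃ p z : UrysonSC E, (∀ x, 0 ≤ (p : E → ℝ) x) ∧ (∀ x, |(φ : E → ℝ) x| ≤ (p : E → ℝ) x) ∧
      (∀ x, 0 ≤ (z : E → ℝ) x) ∧
      ∀ T : UrysonSC E, ∃ c : ℝ, 0 < c ∧ ∀ (n : ℕ) (S : UrysonSC E), (∀ x, (S : E → ℝ) x ≤
        (T : E → ℝ) x) → (∀ x, (S : E → ℝ) x ≤ n * (p : E → ℝ) x) →
          ∀ x, (S : E → ℝ) x ≤ c * (z : E → ℝ) x := by
  obtain ⟨z, hz⟩ := hφ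
  have hp : ∀ x, |(φ : E → ℝ) x| ≤ ((|φ| : UrysonSC E) : E → ℝ) x := fun x => by
    have h1 : φ ≤ |φ| := le_abs_self φ
    have h2 : -φ ≤ |φ| := neg_le_abs φ
    exact abs_le'.2 ⟨h1 x, h2 x⟩
  have hp0 : ∀ x, 0 ≤ ((|φ| : UrysonSC E) : E → ℝ) x := fun x => (abs_nonneg _).trans (hp x)
  have key : ∀ T : UrysonSC E, ∃ c : ℝ, 0 < c ∧ ∀ (n : ℕ) (S : UrysonSC E),
      (∀ x, (S : E → ℝ) x ≤ (T : E → ℝ) x) →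
      (∀ x, (S : E → ℝ) x ≤ n * ((|φ| : UrysonSC E) : E → ℝ) x) →
          ∀ x, (S : E → ℝ) x ≤ c * (z : E → ℝ) x := fun T => by
    obtain ⟨c, hc, h⟩ := hz T
    refine ⟨c, hc, fun n S hT hn x => ?_⟩
    have h1 : S ≤ |T| := le_trans (b := T) hT (le_abs_self T)
    have h2 : S ≤ n • |φ| := fun y => by
      refine (hn y).trans_eq ?_
      simp [nsmul_eq_mul]
    -- The infimum in `UrysonSC E` is not pointwise; working with arbitrary common lower bounds `S`
    -- avoids computing it.
    have h3 : S ≤ c • z := (le_inf h1 h2).trans (h n)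
    exact h3 x
  refine ⟨|φ|, z, hp0, hp, fun x => ?_, key⟩
  -- `T = S = 0` gives `0 ≤ c z`, hence positivity of `z`.
  obtain ⟨c, hc, h⟩ := key 0
  have := h 0 0 (fun x => le_rfl) (fun x => by simp) x
  exact nonneg_of_mul_nonneg_right (by simpa using this) hc

theorem exists_abs_le_of_bdd {A : Set E} (hl : BddBelow A) (hu : BddAbove A) :
    ∃ w : E, ∀ x ∈ A, |x| ≤ w := by
  obtain ⟨l, hl⟩ := hl
  obtain ⟨u, hu⟩ := hu
  refine ⟨|l| ⊔ |u|, fun x hx => abs_le'.2 ⟨?_, ?_⟩⟩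
  · exact (hu hx).trans ((le_abs_self u).trans le_sup_right)
  · exact (neg_le_neg (hl hx)).trans ((neg_le_abs l).trans le_sup_left)

theorem UrysonSC.exists_bound (T : UrysonSC E) (w : E) :
    ∃ K : ℝ, ∀ x, |x| ≤ w → |(T : E → ℝ) x| ≤ K :=
  orderBoundedMap_iff.1 T.2.2.1 {x | |x| ≤ w} ⟨-w, fun _ hx => (bounds_of_abs_le hx).1⟩
    ⟨w, fun _ hx => (bounds_of_abs_le hx).2⟩

/-- Series of functionals that converge uniformly on order intervals. -/
theorem UrysonSC.tsum_mem (T : ℕ → UrysonSC E) (M : E → ℕ → ℝ) (hM : ∀ w, Summable (M w))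
    (hT : ∀ w x k, |x| ≤ w → |(T k : E → ℝ) x| ≤ M w k) :
    (fun x => ∑' k, (T k : E → ℝ) x) ∈ UrysonSC E := by
  have hs : ∀ x, Summable fun k => (T k : E → ℝ) x := fun x =>
    Summable.of_norm_bounded (hM |x|) fun k => hT |x| x k le_rfl
  refine ⟨fun x y h => ?_, orderBoundedMap_iff.2 fun A hl hu => ?_,
    sigmaLaterallyContinuous_iff.2 fun x a h => ?_⟩
  · show ∑' k, (T k : E → ℝ) (x + y) = _
    rw [← (hs x).tsum_add (hs y)]
    exact tsum_congr fun k => (T k).2.1 x y h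
  · obtain ⟨w, hw⟩ := exists_abs_le_of_bdd hl hu
    exact ⟨∑' k, M w k, fun x hx => tsum_of_norm_bounded
      (f := fun k => (T k : E → ℝ) x) (hM w).hasSum fun k => hT w x k (hw x hx)⟩
  · exact tendsto_tsum_of_dominated_convergence (hM |a|)
      (fun k => sigmaLaterallyContinuous_iff.1 (T k).2.2.2 x a h)
      (Eventually.of_forall fun n k => hT |a| (x n) k (h.2.1 n).abs_le)

variable [Module ℝ E] [IsOrderedModule ℝ E]

/-- Positivity makes `p` monotone along fragments, which bounds the map by `p g`. For lateral
continuity, `p (meet hE g (x n))` is squeezed between `p` of the part of `meet hE g a` in `x n` and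
`p (meet hE g a)`. -/
theorem comp_meet_mem (hE : ProjectionProperty E) (p : UrysonSC E) (hp : ∀ x, 0 ≤ (p : E → ℝ) x) (g : E) :
    (fun x => (p : E → ℝ) (meet hE g x)) ∈ UrysonSC E := by
  refine ⟨fun x y h => ?_, orderBoundedMap_iff.2 fun A _ _ => ⟨(p : E → ℝ) g, fun x _ => ?_⟩,
    sigmaLaterallyContinuous_iff.2 fun x a h => ?_⟩
  · show (p : E → ℝ) (meet hE g (x + y)) = _
    rw [meet_add hE g h]
    exact p.2.1 _ _ (h.mono (meet_right hE g x).abs_le (meet_right hE g y).abs_le)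
  · rw [abs_of_nonneg (hp _)]
    exact UrysonSC.mono_fragment hp (meet_left hE g x)
  · have hl := h.common (meet_right hE g a)
    refine tendsto_of_tendsto_of_tendsto_of_le_of_le
      (sigmaLaterallyContinuous_iff.1 p.2.2.2 _ _ hl) tendsto_const_nhds (fun n => ?_) fun n => ?_
    · refine UrysonSC.mono_fragment hp (isFragment_meet hE ((hl.2.1 n).trans (meet_left hE g a)) ?_)
      have h1 : IsFragment (meet hE g a) (x n + (a - x n)) := by
        rw [add_sub_cancel]; exact meet_right hE g a
      exact h1.common_isFragment (h.2.1 n)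
    · exact UrysonSC.mono_fragment hp (isFragment_meet hE (meet_left hE g _)
        ((meet_right hE g _).trans (h.2.1 n)))

/-- The functional `x ↦ p (g ∧ x)`, where `g ∧ x` is the greatest common fragment. -/
noncomputable def compMeet (hE : ProjectionProperty E) (p : UrysonSC E)
    (hp : ∀ x, 0 ≤ (p : E → ℝ) x) (g : E) : UrysonSC E :=
  ⟨fun x => (p : E → ℝ) (meet hE g x), comp_meet_mem hE p hp g⟩

/-- Test functionals `∑ₖ tₖ p (gₖ ∧ ·)` for the majorant `z`. -/
theorem exists_bound_of_majorant (hE : ProjectionProperty E) (p z : UrysonSC E) (hp : ∀ x, 0 ≤ (p : E → ℝ) x)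
    (hz : ∀ T : UrysonSC E, ∃ c : ℝ, 0 < c ∧ ∀ (n : ℕ) (S : UrysonSC E), (∀ x, (S : E → ℝ) x ≤
        (T : E → ℝ) x) → (∀ x, (S : E → ℝ) x ≤ n * (p : E → ℝ) x) →
          ∀ x, (S : E → ℝ) x ≤ c * (z : E → ℝ) x)
    (g : ℕ → E) (t : ℕ → ℝ) (ht : ∀ k, 0 ≤ t k) (M : E → ℕ → ℝ) (hM : ∀ w, Summable (M w))
    (hb : ∀ w x k, |x| ≤ w → t k * (p : E → ℝ) (meet hE (g k) x) ≤ M w k) :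
    ∃ c : ℝ, 0 < c ∧ ∀ k, t k * (p : E → ℝ) (g k) ≤ c * (z : E → ℝ) (g k) := by
  have hnn : ∀ k x, 0 ≤ t k * (p : E → ℝ) (meet hE (g k) x) := fun k x => mul_nonneg (ht k) (hp _)
  have hmem := UrysonSC.tsum_mem (fun k => t k • compMeet hE p hp (g k)) M hM fun w x k hx => by
    show |t k * (p : E → ℝ) (meet hE (g k) x)| ≤ _
    rw [abs_of_nonneg (hnn k x)]
    exact hb w x k hx
  obtain ⟨c, hc, h⟩ := hz ⟨_, hmem⟩
  refine ⟨c, hc, fun k => ?_⟩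
  -- The multiple `n` of `p` may depend on `k`, since `c` depends only on the sum of the series.
  obtain ⟨n, hn⟩ := exists_nat_ge (t k)
  have := h n (t k • compMeet hE p hp (g k)) (fun x => ?_) (fun x => ?_) (g k)
  · change t k * (p : E → ℝ) (meet hE (g k) (g k)) ≤ _ at this
    rwa [meet_self] at this
  · refine Summable.le_tsum (f := fun k => t k * (p : E → ℝ) (meet hE (g k) x)) ?_ k
      fun j _ => hnn j x
    refine Summable.of_nonneg_of_le (fun k => hnn k x) (fun k => hb |x| x k le_rfl) (hM |x|)
  · exact mul_le_mul hn (UrysonSC.mono_fragment hp (meet_right hE (g k) x)) (hp _) (Nat.cast_nonneg n)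

/-- The majorant is bounded away from zero where `p` is positive. -/
theorem exists_pos_le_majorant (hE : ProjectionProperty E) (p z : UrysonSC E) (hp : ∀ x, 0 ≤ (p : E → ℝ) x)
    (hz : ∀ T : UrysonSC E, ∃ c : ℝ, 0 < c ∧ ∀ (n : ℕ) (S : UrysonSC E), (∀ x, (S : E → ℝ) x ≤
        (T : E → ℝ) x) → (∀ x, (S : E → ℝ) x ≤ n * (p : E → ℝ) x) →
          ∀ x, (S : E → ℝ) x ≤ c * (z : E → ℝ) x) :
    ∃ δ : ℝ, 0 < δ ∧ ∀ g, 0 < (p : E → ℝ) g → δ ≤ (z : E → ℝ) g := by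
  by_contra! hcon
  choose g hg hgz using fun k : ℕ => hcon ((1 / 4 : ℝ) ^ k) (by positivity)
  -- With these weights the `k`-th summand is at most `2⁻ᵏ`, with equality at `g k`, where `z <
  -- 4⁻ᵏ`; so `2⁻ᵏ ≤ c 4⁻ᵏ` for all `k`.
  obtain ⟨c, hc, h⟩ := exists_bound_of_majorant hE p z hp hz g
    (fun k => (1 / 2 : ℝ) ^ k / (p : E → ℝ) (g k)) (fun k => div_nonneg (by positivity) (hp _))
    (fun _ k => (1 / 2 : ℝ) ^ k) (fun _ => summable_geometric_two) (fun w x k _ => by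
      rw [div_mul_eq_mul_div, div_le_iff₀ (hg k)]
      exact mul_le_mul_of_nonneg_left (UrysonSC.mono_fragment hp (meet_left hE _ _))
        (by positivity))
  obtain ⟨k, hk⟩ := pow_unbounded_of_one_lt c (one_lt_two (α := ℝ))
  have h1 := h k
  simp only [div_mul_cancel₀ _ (hg k).ne'] at h1
  have h2 : (1 / 2 : ℝ) ^ k ≤ c * (1 / 4 : ℝ) ^ k :=
    h1.trans (mul_le_mul_of_nonneg_left (hgz k).le hc.le)
  have h3 : (1 / 4 : ℝ) ^ k = (1 / 2 : ℝ) ^ k * (1 / 2) ^ k := by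
    rw [← mul_pow]; norm_num
  have h4 : (0 : ℝ) < (1 / 2) ^ k := by positivity
  have h5 : (2 : ℝ) ^ k * (1 / 2) ^ k = 1 := by rw [← mul_pow]; norm_num
  have h6 : c * (1 / 4 : ℝ) ^ k < (1 / 2) ^ k := by
    rw [h3]
    calc c * ((1 / 2 : ℝ) ^ k * (1 / 2) ^ k) < 2 ^ k * ((1 / 2) ^ k * (1 / 2) ^ k) :=
          mul_lt_mul_of_pos_right hk (mul_pos h4 h4)
      _ = (1 / 2) ^ k := by rw [← mul_assoc, h5, one_mul]
  exact absurd h2 h6.not_ge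

end Functionals

/-! ### Two-valued functionals, null bands and atoms -/

section Atoms

variable {E : Type*} [AddCommGroup E] [Lattice E] [IsOrderedAddMonoid E]

theorem pairwise_disj_insert {A : Set E} {u : E} (hA : A.Pairwise Disj)
    (h : ∀ b ∈ A, Disj u b) : (insert u A).Pairwise Disj :=
  Set.pairwise_insert.2 ⟨hA, fun b hb _ => ⟨h b hb, (h b hb).symm⟩⟩

/-- If `z` is at least `δ > 0` wherever `p` is positive, then `p` is two-valued on the fragments of
some fragment. -/
theorem exists_two_valued_fragment {p z : UrysonSC E} (hp : ∀ x, 0 ≤ (p : E → ℝ) x)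
    (hz : ∀ x, 0 ≤ (z : E → ℝ) x) {δ : ℝ} (hδ : 0 < δ)
    (h : ∀ g, 0 < (p : E → ℝ) g → δ ≤ (z : E → ℝ) g) {e : E} (he : 0 < (p : E → ℝ) e) :
    ∃ f, IsFragment f e ∧ 0 < (p : E → ℝ) f ∧
      ∀ g, IsFragment g f → (p : E → ℝ) g = 0 ∨ (p : E → ℝ) (f - g) = 0 := by
  -- `N` bounds the number of splittings: passing to one of two pieces charged by `p` lowers `z` by
  -- at least `δ`.
  obtain ⟨N, hN⟩ := exists_nat_gt ((z : E → ℝ) e / δ)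
  rw [div_lt_iff₀ hδ] at hN
  induction N generalizing e with
  | zero => exact absurd hN (by simpa using hz e)
  | succ N ih =>
    by_cases h2 : ∀ g, IsFragment g e → (p : E → ℝ) g = 0 ∨ (p : E → ℝ) (e - g) = 0
    · exact ⟨e, .refl e, he, h2⟩
    · push Not at h2
      obtain ⟨g, hge, hg, hg'⟩ := h2
      have h3 := h _ (lt_of_le_of_ne (hp _) hg'.symm)
      have h4 := UrysonSC.map_fragment_add z hge
      push_cast at hN
      obtain ⟨f, hf, hf'⟩ := ih (lt_of_le_of_ne (hp _) hg.symm) (by linarith)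
      exact ⟨f, hf.trans hge, hf'⟩

/-- `p` vanishes on all fragments of `f` in the band `S^⊥⊥`. -/
def IsNullBand (p : UrysonSC E) (f : E) (S : Set E) : Prop :=
  ∀ g, IsFragment g f → g ∈ disjCompl (disjCompl S) → (p : E → ℝ) g = 0

theorem IsNullBand.mono {p : UrysonSC E} {f : E} {S T : Set E} (hT : IsNullBand p f T)
    (h : S ⊆ T) : IsNullBand p f S :=
  fun g hg hgS => hT g hg (disjCompl_anti (disjCompl_anti h) hgS)

theorem isNullBand_empty (p : UrysonSC E) (f : E) : IsNullBand p f ∅ := fun g _ hg => by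
  rw [(hg g (by simp [disjCompl])).eq_zero, UrysonSC.map_zero]

/-- A fragment of `f` in the band of `a` is disjoint from `f - a`, hence a fragment of `a`. -/
theorem isNullBand_singleton {p : UrysonSC E} (hp : ∀ x, 0 ≤ (p : E → ℝ) x) {f a : E}
    (ha : IsFragment a f) (hpa : (p : E → ℝ) a = 0) : IsNullBand p f {|a|} := by
  intro g hg hga
  refine UrysonSC.map_fragment_eq_zero hp ?_ hpa
  have h1 : Disj g (f - a) := by
    refine hga _ ?_
    rintro _ rfl
    exact (Disj.symm ha).abs_right
  have h2 := Disj.sub_right hg h1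
  rwa [sub_sub_sub_cancel_left] at h2

variable [Module ℝ E] [IsOrderedModule ℝ E]

theorem IsNullBand.union (hE : ProjectionProperty E) {p : UrysonSC E} {f : E} {S T : Set E}
    (hT : IsNullBand p f T) (hS : IsNullBand p f S) : IsNullBand p f (T ∪ S) := by
  intro g hg hgu
  obtain ⟨a, ha, b, hb, e⟩ := hE.exists_decomp S g
  have hab : Disj a b := (hb a ha).symm
  have hag := isFragment_of_disj_add e hab
  have hbg := isFragment_of_disj_add (e.trans (add_comm a b)) hab.symm
  rw [e, p.2.1 a b hab, hS b (hbg.trans hg) hb,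
    hT a (hag.trans hg) (mem_of_mem_disjCompl_union (disjCompl_solid hgu hag.abs_le) ha), add_zero]

/-- The components `b n` of `g` in the bands of the finite unions `T n` converge laterally to `g`,
and `p` vanishes on each of them. -/
theorem IsNullBand.iUnion (hE : ProjectionProperty E) {p : UrysonSC E} {f : E} {S : ℕ → Set E}
    (hS : ∀ n, IsNullBand p f (S n)) : IsNullBand p f (⋃ n, S n) := by
  intro g hg hgS
  set T : ℕ → Set E := fun n => ⋃ k < n, S k with hTdef
  have hT : ∀ n, IsNullBand p f (T n) := fun n => by
    induction n with
    | zero => simpa [hTdef] using isNullBand_empty p f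
    | succ n ih =>
      have : T (n + 1) = T n ∪ S n := Set.biUnion_lt_succ S n
      rw [this]
      exact ih.union hE (hS n)
  have hTmono : ∀ {n m}, n ≤ m → T n ⊆ T m := fun {n m} hnm =>
    Set.biUnion_mono (fun k hk => lt_of_lt_of_le hk hnm) fun _ _ => le_rfl
  choose a ha b hb e using fun n => hE.exists_decomp (T n) g
  have hab : ∀ {n m}, n ≤ m → Disj (a m) (b n) := fun {n m} hnm =>
    (hb n _ (disjCompl_anti (hTmono hnm) (ha m))).symm
  have hsub : ∀ n m, b m - b n = a n - a m := fun n m => by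
    rw [sub_eq_sub_iff_add_eq_add, add_comm (b m), ← e m, ← e n]
  have hbg : ∀ n, IsFragment (b n) g := fun n =>
    isFragment_of_disj_add ((e n).trans (add_comm _ _)) (hab le_rfl).symm
  have hanti : Antitone fun n => |a n| := fun n m hnm => by
    refine IsFragment.abs_le (y := a m) (x := a n) ?_
    unfold IsFragment
    rw [← hsub]
    exact (hab le_rfl).sub_right (hab hnm)
  have hlat : LatConv b g := by
    refine ⟨fun n m hnm => ?_, hbg, fun n => |a n|, hanti, ⟨?_, fun c hc => ?_⟩, fun n => ?_⟩
    · unfold IsFragment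
      rw [hsub]
      exact (hab le_rfl).symm.sub_right (hab hnm.le).symm
    · rintro _ ⟨n, rfl⟩; exact abs_nonneg _
    -- The remainders `|a n|` decrease to zero: the positive part of a lower bound is disjoint from
    -- every `S n`, hence from `g`, which dominates it.
    · have h1 : ∀ n, |c⁺| ≤ |a n| := fun n => by
        rw [abs_of_nonneg (posPart_nonneg c)]
        exact sup_le (hc ⟨n, rfl⟩) (abs_nonneg _)
      have h2 : c⁺ ∈ disjCompl (⋃ n, S n) := by
        intro y hy
        obtain ⟨i, hi⟩ := Set.mem_iUnion.1 hy
        refine disjCompl_solid (ha (i + 1)) (h1 (i + 1)) y ?_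
        exact Set.mem_biUnion (show i < i + 1 from i.lt_succ_self) hi
      have h3 : |a 0| ≤ |g| := IsFragment.abs_le (isFragment_of_disj_add (e 0) (hab le_rfl))
      exact posPart_eq_zero.1 ((hgS _ h2).symm.eq_zero_of_abs_le ((h1 0).trans h3))
    · rw [e n, abs_sub_comm, add_sub_cancel_right]
  have hlim := sigmaLaterallyContinuous_iff.1 p.2.2.2 b g hlat
  have h0 : (fun n => (p : E → ℝ) (b n)) = fun _ => 0 :=
    funext fun n => hT n _ ((hbg n).trans hg) (hb n)
  rw [h0] at hlim
  exact tendsto_nhds_unique hlim tendsto_const_nhds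

/-- On a nonmeasurable disjoint family of null bands a two-valued functional is null. -/
theorem isNullBand_of_two_valued (hE : ProjectionProperty E) {p : UrysonSC E}
    (hp : ∀ x, 0 ≤ (p : E → ℝ) x) {f : E}
    (h2 : ∀ g, IsFragment g f → (p : E → ℝ) g = 0 ∨ (p : E → ℝ) (f - g) = 0) {A : Set E}
    (hA : A.Pairwise Disj) (hcard : IsNonmeasurable A) (hnull : ∀ a ∈ A, IsNullBand p f {a}) :
    IsNullBand p f A := by
  by_contra hcon
  have hU : ∀ C : Set (Set A), C.Countable → (∀ s ∈ C, IsNullBand p f ((↑) '' s)) →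
      IsNullBand p f ((↑) '' ⋃₀ C) := fun C hC h => by
    rcases C.eq_empty_or_nonempty with rfl | hne
    · simpa using isNullBand_empty p f
    · obtain ⟨s, rfl⟩ := hC.exists_eq_range hne
      rw [Set.sUnion_range, Set.image_iUnion]
      exact IsNullBand.iUnion hE fun n => h _ ⟨n, rfl⟩
  have hmono : ∀ t : Set A, IsNullBand p f ((↑) '' t) → ∀ s ⊆ t, IsNullBand p f ((↑) '' s) :=
    fun t ht s hs => ht.mono (Set.image_mono hs)
  -- The sets with null complement. Two-valuedness makes this an ultrafilter: if the band of `s`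
  -- contains a fragment `g` of `f` charged by `p`, then `p (f - g) = 0`, and fragments of `f` in
  -- the band of `sᶜ` lie in `f - g`.
  let F : Filter A := Filter.ofCountableUnion {s | IsNullBand p f (Subtype.val '' s)} hU hmono
  have hF : ∀ s, s ∈ F ↔ IsNullBand p f ((↑) '' sᶜ) := fun s => Iff.rfl
  have hcompl : ∀ s, sᶜ ∉ F ↔ s ∈ F := fun s => by
    rw [hF, hF, compl_compl]
    constructor
    · intro hs
      unfold IsNullBand at hs
      push Not at hs
      obtain ⟨g, hgf, hgs, hg⟩ := hs
      intro k hkf hks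
      have hgk : Disj k g := by
        refine hks g fun y hy => ?_
        refine hgs y ?_
        rintro _ ⟨w, hw, rfl⟩
        obtain ⟨v, hv, rfl⟩ := hy
        exact hA v.2 w.2 fun h => hv (Subtype.ext h ▸ hw)
      exact UrysonSC.map_fragment_eq_zero hp (hkf.sub_of_disj hgk) ((h2 g hgf).resolve_left hg)
    · intro h1 h3
      refine hcon ((h1.union hE h3).mono fun x hx => ?_)
      by_cases hxs : (⟨x, hx⟩ : A) ∈ s
      · exact Or.inr ⟨_, hxs, rfl⟩
      · exact Or.inl ⟨_, hxs, rfl⟩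
  obtain ⟨a, ha⟩ := hcard (Ultrafilter.ofComplNotMemIff F hcompl)
    (Filter.countableInter_ofCountableUnion _ hU hmono)
  have h1 : ({a}ᶜ : Set A) ∈ F := by
    rw [hF, compl_compl, Set.image_singleton]
    exact hnull a a.2
  have h3 : ({a}ᶜ : Set A) ∈ (pure a : Ultrafilter A) := ha ▸ h1
  exact h3 rfl

/-- Under the nonmeasurability assumption a two-valued functional is carried by an atom. -/
theorem exists_atom_of_two_valued (hE : ProjectionProperty E)
    (hcard : ∀ A : Set E, A.Pairwise Disj → (∀ a ∈ A, 0 ≤ a) → BddAbove A → IsNonmeasurable A)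
    {p : UrysonSC E} (hp : ∀ x, 0 ≤ (p : E → ℝ) x) {f : E} (hf : 0 < (p : E → ℝ) f)
    (h2 : ∀ g, IsFragment g f → (p : E → ℝ) g = 0 ∨ (p : E → ℝ) (f - g) = 0) :
    ∃ u, IsFragment u f ∧ 0 < (p : E → ℝ) u ∧ IsAtomElt u := by
  -- Absolute values are taken because `hcard` concerns positive elements; the family is bounded by
  -- `|f|`.
  set N : Set E := {a | ∃ g, IsFragment g f ∧ g ≠ 0 ∧ (p : E → ℝ) g = 0 ∧ |g| = a} with hN
  obtain ⟨A, hA⟩ := zorn_subset {A : Set E | A ⊆ N ∧ A.Pairwise Disj} fun c hc hchain =>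
    ⟨⋃₀ c, ⟨Set.sUnion_subset fun s hs => (hc hs).1,
      (Set.pairwise_sUnion hchain.directedOn).2 fun s hs => (hc hs).2⟩,
      fun s hs => Set.subset_sUnion_of_mem hs⟩
  have hAN := hA.prop.1
  have hAd := hA.prop.2
  have hnull : IsNullBand p f A := by
    refine isNullBand_of_two_valued hE hp h2 hAd (hcard A hAd ?_ ⟨|f|, ?_⟩) fun a ha => ?_
    · intro a ha
      obtain ⟨g, -, -, -, rfl⟩ := hAN ha
      exact abs_nonneg g
    · intro a ha
      obtain ⟨g, hg, -, -, rfl⟩ := hAN ha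
      exact hg.abs_le
    · obtain ⟨g, hg, -, hpg, rfl⟩ := hAN ha
      exact isNullBand_singleton hp hg hpg
  have hmax : ∀ g, IsFragment g f → g ∈ disjCompl A → (p : E → ℝ) g = 0 → g = 0 := by
    intro g hg hgA hpg
    by_contra hg0
    have hmem : |g| ∈ A := by
      refine hA.mem_of_prop_insert ⟨Set.insert_subset ⟨g, hg, hg0, hpg, rfl⟩ hAN, ?_⟩
      exact pairwise_disj_insert hAd fun b hb => (hgA b hb).symm.abs_right.symm
    refine hg0 ((hgA _ hmem).eq_zero_of_abs_le ?_)
    rw [abs_abs]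
  obtain ⟨u, hu, v, hv, e⟩ := hE.exists_decomp A f
  have huv : Disj u v := (hv u hu).symm
  have huf := isFragment_of_disj_add e huv
  have hpu : 0 < (p : E → ℝ) u := by
    have h1 := p.2.1 u v huv
    rw [← e, hnull v (isFragment_of_disj_add (e.trans (add_comm u v)) huv.symm) hv,
      add_zero] at h1
    rwa [← h1]
  refine ⟨u, huf, hpu, fun h => ?_, fun x y hx hxu hy hyu hxy => ?_⟩
  · rw [h, UrysonSC.map_zero] at hpu; exact lt_irrefl _ hpu
  -- By two-valuedness `p` vanishes on `a` or on `b`, and by maximality of `A` that part is zero. So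
  -- `u` is disjoint from `x`, giving `x = 0`, or lies in the band of `x`, giving `y = 0`.
  · obtain ⟨a, ha, b, hb, e'⟩ := hE.exists_decomp {x} u
    have hab : Disj a b := (hb a ha).symm
    have hau := isFragment_of_disj_add e' hab
    have hbu := isFragment_of_disj_add (e'.trans (add_comm a b)) hab.symm
    have hb' : a = u - b := by rw [e', add_sub_cancel_right]
    rcases h2 b (hbu.trans huf) with h | h
    · left
      have hb0 := hmax b (hbu.trans huf) (disjCompl_solid hu hbu.abs_le) h
      rw [hb0, add_zero] at e'
      refine (e' ▸ ha x rfl : Disj u x).symm.eq_zero_of_abs_le ?_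
      rwa [abs_of_nonneg hx]
    · right
      have hpa : (p : E → ℝ) a = 0 :=
        UrysonSC.map_fragment_eq_zero hp ((hau.trans huf).sub_of_disj hab) h
      have ha0 := hmax a (hau.trans huf) (disjCompl_solid hu hau.abs_le) hpa
      rw [ha0, zero_add] at e'
      have hyx : y ∈ disjCompl {x} := by
        rintro _ rfl
        unfold Disj
        rwa [abs_of_nonneg hx, abs_of_nonneg hy, inf_comm]
      have := hb y hyx
      rw [← e'] at this
      refine this.symm.eq_zero_of_abs_le ?_
      rwa [abs_of_nonneg hy]

/-! ### Disjoint sequences of atoms -/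

theorem IsAtomElt.eq_zero_or_eq {u f : E} (hu : IsAtomElt u) (hf : IsFragment f u) :
    f = 0 ∨ f = u := by
  rcases hu.2 |f| |u - f| (abs_nonneg _) hf.abs_le (abs_nonneg _) hf.compl.abs_le hf with h | h
  · exact Or.inl ((Disj.eq_zero (x := f) (by unfold Disj; rw [h, inf_idem])))
  · refine Or.inr (sub_eq_zero.1 (Disj.eq_zero (x := u - f) ?_)).symm
    unfold Disj; rw [h, inf_idem]

/-- A finite sum of disjoint elements dominated by `w` is dominated by `w`. -/
theorem abs_sum_le_of_disj {ι : Type*} (u : ι → E) (s : Finset ι)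
    (hd : (s : Set ι).Pairwise fun i j => Disj (u i) (u j)) {w : E} (hw0 : 0 ≤ w)
    (hw : ∀ i ∈ s, |u i| ≤ w) : |∑ i ∈ s, u i| ≤ w := by
  classical
  induction s using Finset.induction_on with
  | empty => simpa
  | insert i s hi ih =>
    rw [Finset.coe_insert] at hd
    have h1 := ih (hd.mono (Set.subset_insert _ _)) fun j hj => hw j (Finset.mem_insert_of_mem hj)
    have h2 : Disj (u i) (∑ j ∈ s, u j) :=
      Finset.sum_induction _ (Disj (u i)) (fun _ _ => Disj.add_right) (disj_zero_right _)
        fun j hj => hd (Set.mem_insert _ _) (Set.mem_insert_of_mem _ hj) (by rintro rfl; exact hi hj)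
    rw [Finset.sum_insert hi]
    refine (abs_add_le _ _).trans ?_
    rw [← sup_eq_add_of_inf h2]
    exact sup_le (hw i (Finset.mem_insert_self _ _)) h1

theorem UrysonSC.map_sum_of_disj (T : UrysonSC E) {ι : Type*} (u : ι → E) (s : Finset ι)
    (hd : (s : Set ι).Pairwise fun i j => Disj (u i) (u j)) :
    (T : E → ℝ) (∑ i ∈ s, u i) = ∑ i ∈ s, (T : E → ℝ) (u i) := by
  classical
  induction s using Finset.induction_on with
  | empty => simpa using UrysonSC.map_zero T
  | insert i s hi ih =>
    rw [Finset.coe_insert] at hd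
    have h2 : Disj (u i) (∑ j ∈ s, u j) :=
      Finset.sum_induction _ (Disj (u i)) (fun _ _ => Disj.add_right) (disj_zero_right _)
        fun j hj => hd (Set.mem_insert _ _) (Set.mem_insert_of_mem _ hj) (by rintro rfl; exact hi hj)
    rw [Finset.sum_insert hi, Finset.sum_insert hi, T.2.1 _ _ h2,
      ih (hd.mono (Set.subset_insert _ _))]

/-- A disjoint sequence on which a functional stays away from zero meets every order interval
in a finite set. -/
theorem finite_setOf_abs_le (z : UrysonSC E) {δ : ℝ} (hδ : 0 < δ) (u : ℕ → E)
    (hd : Pairwise fun i j => Disj (u i) (u j)) (hu : ∀ k, δ ≤ (z : E → ℝ) (u k)) (w : E) :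
    {k | |u k| ≤ w}.Finite := by
  by_contra hinf
  obtain ⟨K, hK⟩ := UrysonSC.exists_bound z w
  obtain ⟨n, hn⟩ := exists_nat_gt (K / δ)
  rw [div_lt_iff₀ hδ] at hn
  obtain ⟨s, hs, hcard⟩ := Set.Infinite.exists_subset_card_eq hinf n
  have hds : (s : Set ℕ).Pairwise fun i j => Disj (u i) (u j) := fun i _ j _ hij => hd hij
  have hw0 : 0 ≤ w := by
    obtain ⟨k, hk⟩ := Set.Infinite.nonempty hinf
    exact (abs_nonneg _).trans hk
  -- The sum of `n` disjoint terms stays in the order interval of `w`, while `z` of it is at least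
  -- `n * δ > K`.
  have h1 := (le_abs_self _).trans (hK _ (abs_sum_le_of_disj u s hds hw0 fun i hi => hs hi))
  rw [UrysonSC.map_sum_of_disj z u s hds] at h1
  have h2 : n * δ ≤ ∑ i ∈ s, (z : E → ℝ) (u i) := by
    have := Finset.card_nsmul_le_sum s (fun i => (z : E → ℝ) (u i)) δ fun i _ => hu i
    rwa [hcard, nsmul_eq_mul] at this
  linarith

/-- There is no infinite disjoint sequence of atoms on which `p` is positive. -/
theorem not_infinite_atoms (hE : ProjectionProperty E) (p z : UrysonSC E)
    (hp : ∀ x, 0 ≤ (p : E → ℝ) x)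
    (hz : ∀ T : UrysonSC E, ∃ c : ℝ, 0 < c ∧ ∀ (n : ℕ) (S : UrysonSC E), (∀ x, (S : E → ℝ) x ≤
        (T : E → ℝ) x) → (∀ x, (S : E → ℝ) x ≤ n * (p : E → ℝ) x) →
          ∀ x, (S : E → ℝ) x ≤ c * (z : E → ℝ) x) {δ : ℝ} (hδ : 0 < δ)
    (h : ∀ g, 0 < (p : E → ℝ) g → δ ≤ (z : E → ℝ) g) (u : ℕ → E)
    (hd : Pairwise fun i j => Disj (u i) (u j)) (hu : ∀ k, IsAtomElt (u k))
    (hpu : ∀ k, 0 < (p : E → ℝ) (u k)) : False := by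
  classical
  have hzu : ∀ k, 0 < (z : E → ℝ) (u k) := fun k => hδ.trans_le (h _ (hpu k))
  have ht : ∀ k : ℕ, 0 ≤ k * (z : E → ℝ) (u k) / (p : E → ℝ) (u k) := fun k =>
    div_nonneg (mul_nonneg k.cast_nonneg (hzu k).le) (hp _)
  -- The weights make the `k`-th summand equal to `k * z (u k)` at `u k`, which beats `c * z (u k)`.
  -- For `|x| ≤ w` the meet of `u k` and `x` is `0` or `u k`, the latter only if `|u k| ≤ w`, so
  -- only finitely many summands matter.
  obtain ⟨c, hc, hck⟩ := exists_bound_of_majorant hE p z hp hz u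
    (fun k => k * (z : E → ℝ) (u k) / (p : E → ℝ) (u k)) ht
    (fun w k => if |u k| ≤ w then k * (z : E → ℝ) (u k) else 0) (fun w => by
      refine summable_of_hasFiniteSupport ((finite_setOf_abs_le z hδ u hd
        (fun k => h _ (hpu k)) w).subset fun k hk => ?_)
      by_contra hkw
      exact hk (if_neg hkw)) (fun w x k hx => by
      rcases (hu k).eq_zero_or_eq (meet_left hE (u k) x) with h0 | h0
      · rw [h0, UrysonSC.map_zero, mul_zero]
        split_ifs
        · exact mul_nonneg k.cast_nonneg (hzu k).le
        · exact le_rfl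
      · have h1 := (meet_right hE (u k) x).abs_le.trans hx
        rw [h0] at h1 ⊢
        rw [if_pos h1, div_mul_cancel₀ _ (hpu k).ne'])
  obtain ⟨k, hk⟩ := exists_nat_gt c
  have h1 := hck k
  rw [div_mul_cancel₀ _ (hpu k).ne'] at h1
  exact absurd (le_of_mul_le_mul_right h1 (hzu k)) hk.not_ge

end Atoms

end VL

theorem theorem4p11 {E : Type*} [AddCommGroup E] [Lattice E] [IsOrderedAddMonoid E]
    [Module ℝ E] [IsOrderedModule ℝ E]
    (hE : VL.ProjectionProperty E)
    (hcard : ∀ A : Set E, A.Pairwise VL.Disj → (∀ a ∈ A, 0 ≤ a) → BddAbove A →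
      VL.IsNonmeasurable A)
    (φ : VL.UrysonSC E) (hφ : VL.IsFiniteElement φ) :
    ∃ s : Finset E,
      (∀ u ∈ s, VL.IsAtomElt u) ∧
      (s : Set E).Pairwise VL.Disj ∧
      VL.IsProjectionBand (VL.bandGenerated (s : Set E)) ∧
      FiniteDimensional ℝ (VL.bandGenerated (s : Set E)) ∧
      ∀ x ∈ VL.disjCompl (VL.bandGenerated (s : Set E) : Set E), (φ : E → ℝ) x = 0 := by
  obtain ⟨p, z, hp, hφp, hz, hmaj⟩ := hφ.exists_majorant
  obtain ⟨δ, hδ, hpz⟩ := VL.exists_pos_le_majorant hE p z hp hmaj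
  obtain ⟨A, hA⟩ := zorn_subset
    {A : Set E | A ⊆ {u | VL.IsAtomElt u ∧ 0 < (p : E → ℝ) u} ∧ A.Pairwise VL.Disj}
    fun c hc hchain => ⟨⋃₀ c, ⟨Set.sUnion_subset fun s hs => (hc hs).1,
      (Set.pairwise_sUnion hchain.directedOn).2 fun s hs => (hc hs).2⟩,
      fun s hs => Set.subset_sUnion_of_mem hs⟩
  have hAa := hA.prop.1
  have hAd := hA.prop.2
  have hfin : A.Finite := by
    by_contra hinf
    have := Set.Infinite.to_subtype hinf
    let u := Infinite.natEmbedding A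
    exact VL.not_infinite_atoms hE p z hp hmaj hδ hpz (fun k => (u k : E))
      (fun i j hij => hAd (u i).2 (u j).2 fun h => hij (u.injective (Subtype.ext h)))
      (fun k => (hAa (u k).2).1) fun k => (hAa (u k).2).2
  lift A to Finset E using hfin
  refine ⟨A, fun u hu => (hAa hu).1, hAd, hE _ (VL.IsBand.bandGenerated _), ?_, fun x hx => ?_⟩
  · exact Submodule.finiteDimensional_of_le
      (hE.bandGenerated_le_span A fun u hu => (hAa hu).1)
  · by_contra hne
    have hpx : 0 < (p : E → ℝ) x := (abs_pos.2 hne).trans_le (hφp x)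
    obtain ⟨f, hfx, hpf, h2⟩ := VL.exists_two_valued_fragment hp hz hδ hpz hpx
    obtain ⟨u, huf, hpu, hu⟩ := VL.exists_atom_of_two_valued hE hcard hp hpf h2
    have huA : ∀ a ∈ (A : Set E), VL.Disj u a := fun a ha =>
      (hx a (VL.subset_bandGenerated _ ha)).mono (huf.trans hfx).abs_le le_rfl
    -- Maximality puts `u` into `A`, although `u` is disjoint from every element of `A`, so `u`
    -- would be disjoint from itself.
    have hmem : u ∈ (A : Set E) := by
      refine hA.mem_of_prop_insert ⟨Set.insert_subset ⟨hu, hpu⟩ hAa, ?_⟩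
      exact VL.pairwise_disj_insert hAd huA
    exact hu.1 (huA u hmem).eq_zero
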